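/- Let $N\ge 2$, let $\Omega\subset\mathbb R^N$ be open and bounded, $1<p<N$, $\theta\ge 0$, $\gamma_2\ge 0$ with $\theta<1+\frac{\gamma_2}{p-1}$. Let $a:\Omega\times\mathbb R\times\mathbb R^N\to\mathbb R^N$ be a Carathéodory function such that, for a.e. $x\in\Omega$, all $s\in\mathbb R$ and all $\xi\in\mathbb R^N$, $$a(x,s,\xi)\cdot\xi\ \ge\ b(s)|\xi|^p,$$ where $b:\mathbb R\to\mathbb R$ is continuous and bounded and, for some $\alpha>0$, $b(s)\ge \frac{\alpha}{(1+|s|)^{\theta(p-1)}}$ for all $s\in\mathbb R$. Let $h:[0,\infty)\to[0,\infty]$ be continuous, finite on $(0,\infty)$, and such that $h(s)\le c_2 s^{-\gamma_2}$ for all $s\ge s_2$, for some $c_2,s_2>0$. Let $f\in L^1(\Omega)$ with $f\ge 0$ a.e. in $\Omega$. Notation. For $k>0$ let $T_k(s)=\max(-k,\min(s,k))$. If $u$ is measurable and $T_k(u)\in W^{1,1}_{\rm loc}(\Omega)$ for all $k>0$, then $\nabla u$ denotes the a.e. unique measurable $v:\Omega\to\mathbb R^N$ with $\nabla T_k(u)=v\,\chi_{\{|u|\le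 k\}}$ a.e. in $\Omega$ for every $k>0$. For $s>0$, a measurable $w:\Omega\to\mathbb R$ belongs to $M^s(\Omega)$ if there is $c>0$ with $|\{x\in\Omega:|w(x)|>\lambda\}|\le c\lambda^{-s}$ for all $\lambda>0$. An *entropy solution* of $$-\operatorname{div}(a(x,u,\nabla u))=h(u)f\ \text{ in }\Omega,\qquad u\ge0\ \text{ in }\Omega,\qquad u=0\ \text{ on }\partial\Omega$$ is a nonnegative, measurable, a.e. finite function $u$ such that $T_k(u)\in W^{1,p}_0(\Omega)$ for every $k>0$ and, for every $k>0$ and every $\varphi\in W^{1,p}_0(\Omega)\cap L^\infty(\Omega)$, $a(x,T_k(u),\nabla T_k(u))\in L^{\frac p{p-1}}(\Omega)^N$, $h(u)fT_k(u-\varphi)\in L^1(\Omega)$ (with $\infty\cdot 0=0$) and $$\int_\Omega a(x,u,\nabla u)\cdot\nabla T_k(u-\varphi)\ \le\ \int_\Omega h(u)f\,T_k(u-\varphi).$$ Then every entropy solution $u$ satisfies: (i) if $\gamma_2\ge1$ and $\theta\le\frac{\gamma_2-1}{p-1}$, then $u\in W^{1,p}_0(\Omega)$; (ii) if $\theta\ge\max\left(0,\frac{\gamma_2-1}{p-1}\right)$,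 then $u\in M^t(\Omega)$ and $|\nabla u|\in M^r(\Omega)$, where $$t=\frac{N((p-1)(1-\theta)+\gamma_2)}{N-p},\qquad r=\frac{N((p-1)(1-\theta)+\gamma_2)}{N-\theta(p-1)-1+\gamma_2},$$ and $t,r>0$. -/

import Mathlib

open MeasureTheory Filter Topology Set
open scoped ENNReal ContDiff

noncomputable section

/-- The truncation `T_k(s) = max (-k, min (s, k))`. -/
def trunc (k s : ℝ) : ℝ := max (-k) (min s k)

/-- `φ ∈ C_c^∞(Ω)`: smooth, with compact support contained in `Ω`. -/
structure IsTestFun {N : ℕ} (Ω : Set (EuclideanSpace ℝ (Fin N)))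
    (φ : EuclideanSpace ℝ (Fin N) → ℝ) : Prop where
  smooth : ContDiff ℝ ∞ φ
  compact : HasCompactSupport φ
  supp : tsupport φ ⊆ Ω

/-- `u ∈ W^{1,1}_loc(Ω)` and `g` is its weak (distributional) gradient. -/
structure IsWeakGrad {N : ℕ} (Ω : Set (EuclideanSpace ℝ (Fin N)))
    (u : EuclideanSpace ℝ (Fin N) → ℝ)
    (g : EuclideanSpace ℝ (Fin N) → EuclideanSpace ℝ (Fin N)) : Prop where
  locInt : LocallyIntegrableOn u Ω volume
  locInt_grad : LocallyIntegrableOn g Ω volume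
  byParts : ∀ φ : EuclideanSpace ℝ (Fin N) → ℝ, IsTestFun Ω φ →
    ∫ x in Ω, u x • gradient φ x = - ∫ x in Ω, φ x • g x

open Classical in
/-- The weak gradient of `u` in `Ω` (unique up to null sets); the zero function when
`u` has none. -/
def weakGrad {N : ℕ} (Ω : Set (EuclideanSpace ℝ (Fin N)))
    (u : EuclideanSpace ℝ (Fin N) → ℝ) :
    EuclideanSpace ℝ (Fin N) → EuclideanSpace ℝ (Fin N) :=
  if h : ∃ g, IsWeakGrad Ω u g then h.choose else 0

/-- The Sobolev space `W^{1,p}_0(Ω)`: the functions of `W^{1,p}(Ω)` that are limits, in the norm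
of `W^{1,p}(Ω)`, of functions of `C_c^∞(Ω)`. -/
def MemW0 {N : ℕ} (Ω : Set (EuclideanSpace ℝ (Fin N))) (p : ℝ)
    (u : EuclideanSpace ℝ (Fin N) → ℝ) : Prop :=
  MemLp u (ENNReal.ofReal p) (volume.restrict Ω) ∧
  ∃ g : EuclideanSpace ℝ (Fin N) → EuclideanSpace ℝ (Fin N),
    IsWeakGrad Ω u g ∧ MemLp g (ENNReal.ofReal p) (volume.restrict Ω) ∧
    ∃ φ : ℕ → EuclideanSpace ℝ (Fin N) → ℝ, (∀ n, IsTestFun Ω (φ n)) ∧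
      Tendsto (fun n => eLpNorm (fun x => φ n x - u x) (ENNReal.ofReal p) (volume.restrict Ω))
        atTop (𝓝 0) ∧
      Tendsto (fun n => eLpNorm (fun x => gradient (φ n) x - g x) (ENNReal.ofReal p)
        (volume.restrict Ω)) atTop (𝓝 0)

/-- `v` is a gradient of `u` in the sense of truncations: `v` is measurable and, for every `k > 0`,
`T_k(u) ∈ W^{1,1}_loc(Ω)` with `∇ T_k(u) = v χ_{|u| ≤ k}`. -/
structure IsTruncGrad {N : ℕ} (Ω : Set (EuclideanSpace ℝ (Fin N)))
    (u : EuclideanSpace ℝ (Fin N) → ℝ)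
    (v : EuclideanSpace ℝ (Fin N) → EuclideanSpace ℝ (Fin N)) : Prop where
  meas : AEStronglyMeasurable v (volume.restrict Ω)
  trunc_grad : ∀ k : ℝ, 0 < k →
    IsWeakGrad Ω (fun x => trunc k (u x)) (indicator {x | |u x| ≤ k} v)

open Classical in
/-- The gradient `∇u` of a measurable function all of whose truncations lie in
`W^{1,1}_loc(Ω)`: the function `v`, unique up to null sets, with `∇ T_k(u) = v χ_{|u| ≤ k}` for
every `k > 0`; the zero function when there is none. -/
def truncGrad {N : ℕ} (Ω : Set (EuclideanSpace ℝ (Fin N)))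
    (u : EuclideanSpace ℝ (Fin N) → ℝ) :
    EuclideanSpace ℝ (Fin N) → EuclideanSpace ℝ (Fin N) :=
  if h : ∃ v, IsTruncGrad Ω u v then h.choose else 0

/-- The Marcinkiewicz space `M^s(Ω)`, `s > 0`. -/
def MemMarcinkiewicz {N : ℕ} (Ω : Set (EuclideanSpace ℝ (Fin N))) (s : ℝ)
    (u : EuclideanSpace ℝ (Fin N) → ℝ) : Prop :=
  0 < s ∧ AEStronglyMeasurable u (volume.restrict Ω) ∧
  ∃ c : ℝ, 0 < c ∧ ∀ l : ℝ, 0 < l →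
    volume {x | x ∈ Ω ∧ l < |u x|} ≤ ENNReal.ofReal (c / l ^ s)

/-- `a : Ω × ℝ × ℝ^N → ℝ^N` is a Carathéodory function: measurable in `x` for all `(s, ξ)`,
continuous in `(s, ξ)` for almost every `x ∈ Ω`. -/
structure IsCaratheodory {N : ℕ} (Ω : Set (EuclideanSpace ℝ (Fin N)))
    (a : EuclideanSpace ℝ (Fin N) → ℝ → EuclideanSpace ℝ (Fin N) → EuclideanSpace ℝ (Fin N)) :
    Prop where
  meas : ∀ (s : ℝ) (ξ : EuclideanSpace ℝ (Fin N)),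
    AEStronglyMeasurable (fun x => a x s ξ) (volume.restrict Ω)
  cont : ∀ᵐ x ∂(volume.restrict Ω),
    Continuous (fun q : ℝ × EuclideanSpace ℝ (Fin N) => a x q.1 q.2)

/-- The product `h(u(x)) f(x) ∈ [0, ∞]`, with the convention `∞ · 0 = 0`. -/
def source {N : ℕ} (h : ℝ → ℝ≥0∞) (f u : EuclideanSpace ℝ (Fin N) → ℝ)
    (x : EuclideanSpace ℝ (Fin N)) : ℝ≥0∞ :=
  h (u x) * ENNReal.ofReal (f x)

/-- `u` is an entropy solution of `-div a(x, u, ∇u) = h(u) f` in `Ω`, `u ≥ 0` in `Ω`, `u = 0` on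
`∂Ω`. The datum `f` is nonnegative and `h` takes values in `[0, ∞]`. The condition
`h(u) f T_k(u - φ) ∈ L¹(Ω)` is the finiteness of the integral of the `[0, ∞]`-valued function
`h(u) f |T_k(u - φ)|`; under it the product is finite almost everywhere, and its integral is that
of the real function `(h(u) f).toReal * T_k(u - φ)`. -/
structure IsEntropySolution {N : ℕ} (Ω : Set (EuclideanSpace ℝ (Fin N))) (p : ℝ)
    (a : EuclideanSpace ℝ (Fin N) → ℝ → EuclideanSpace ℝ (Fin N) → EuclideanSpace ℝ (Fin N))
    (h : ℝ → ℝ≥0∞) (f u : EuclideanSpace ℝ (Fin N) → ℝ) : Prop where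
  meas : AEStronglyMeasurable u (volume.restrict Ω)
  nonneg : ∀ᵐ x ∂(volume.restrict Ω), 0 ≤ u x
  trunc_mem : ∀ k : ℝ, 0 < k → MemW0 Ω p (fun x => trunc k (u x))
  flux_mem : ∀ k : ℝ, 0 < k →
    MemLp (fun x => a x (trunc k (u x)) (weakGrad Ω (fun y => trunc k (u y)) x))
      (ENNReal.ofReal (p / (p - 1))) (volume.restrict Ω)
  source_int : ∀ k : ℝ, 0 < k → ∀ φ : EuclideanSpace ℝ (Fin N) → ℝ,
    MemW0 Ω p φ → MemLp φ ⊤ (volume.restrict Ω) →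
    ∫⁻ x in Ω, source h f u x * ENNReal.ofReal |trunc k (u x - φ x)| < ⊤
  entropy : ∀ k : ℝ, 0 < k → ∀ φ : EuclideanSpace ℝ (Fin N) → ℝ,
    MemW0 Ω p φ → MemLp φ ⊤ (volume.restrict Ω) →
    ∫ x in Ω, inner ℝ (a x (u x) (truncGrad Ω u x))
        (weakGrad Ω (fun y => trunc k (u y - φ y)) x)
      ≤ ∫ x in Ω, (source h f u x).toReal * trunc k (u x - φ x)

end

/-! ### Weak gradients: uniqueness, stability under limits, smooth functions -/

section WeakGradient

variable {N : ℕ} {Ω : Set (EuclideanSpace ℝ (Fin N))}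

/-! Write τ = θ(p-1) and σ = τ + 1 - γ₂. Everything follows from one growth estimate: the integral
of |∇u|^p over {u ≤ k} is at most C max(1, k^σ) for k ≥ 1.

To get it, the entropy inequality is tested with φ = T_n(u) and truncation level 1, for integers n ≥
max(1, s₂). The gradient of T_1(u - T_n(u)) lives on the slice {n < u ≤ n+1}, where b(u) ≥
α(2+n)^{-τ}. The right-hand side lives on {u > n}, where h(u) ≤ c₂ u^{-γ₂}, so the behaviour of h
near 0 plays no role (`IsEntropySolution.slice_energy_le`). Summing the slices below K inside the
integral leaves, at each point, the sum of (2+n)^τ u^{-γ₂} over n < min(u, K), of order at most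
max(1, K^σ) (`sum_slice_weight_le`). The energy below the first slice is finite because that
truncation lies in W^{1,p}_0. This gives `IsEntropySolution.exists_energy_le`.

If σ ≤ 0, the truncations are bounded in W^{1,p}_0(Ω), and Fatou's lemma, Sobolev's inequality and
closedness put u there (`IsTruncGrad.memW0_of_bound`). If σ ≥ 0, Sobolev and Chebyshev applied to
T_k(u) give |{u > k}| ≤ c k^{-t} with t = N(p-σ)/(N-p). Splitting {|∇u| > l} at an optimal level of
u gives the exponent pt/(t+σ) = r. The assumption θ < 1 + γ₂/(p-1) says exactly that p - σ > 0.

Since `weakGrad` and `truncGrad` are defined by choice with default 0, the existence of ∇u and the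
formulas for gradients of truncations have to be established first. -/

theorem IsTestFun.continuous_gradient {φ : EuclideanSpace ℝ (Fin N) → ℝ} (hφ : IsTestFun Ω φ) :
    Continuous (gradient φ) := by
  have := hφ.smooth.continuous_fderiv (by simp)
  exact (InnerProductSpace.toDual ℝ _).symm.continuous.comp this

theorem norm_gradient (φ : EuclideanSpace ℝ (Fin N) → ℝ) (x : EuclideanSpace ℝ (Fin N)) :
    ‖gradient φ x‖ = ‖fderiv ℝ φ x‖ := by
  rw [gradient, LinearIsometryEquiv.norm_map]

theorem support_gradient_subset (φ : EuclideanSpace ℝ (Fin N) → ℝ) :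
    Function.support (gradient φ) ⊆ tsupport φ := by
  intro x hx
  apply support_fderiv_subset ℝ
  intro h
  apply hx
  rw [gradient, h, map_zero]

theorem IsTestFun.hasCompactSupport_gradient {φ : EuclideanSpace ℝ (Fin N) → ℝ}
    (hφ : IsTestFun Ω φ) : HasCompactSupport (gradient φ) :=
  HasCompactSupport.intro hφ.compact fun x hx => by
    by_contra h
    exact hx (support_gradient_subset φ h)

theorem IsTestFun.exists_bound {φ : EuclideanSpace ℝ (Fin N) → ℝ} (hφ : IsTestFun Ω φ) :
    ∃ C : ℝ, ∀ x, ‖φ x‖ ≤ C ∧ ‖gradient φ x‖ ≤ C := by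
  obtain ⟨C, hC⟩ := hφ.compact.exists_bound_of_continuous hφ.smooth.continuous
  obtain ⟨D, hD⟩ := hφ.hasCompactSupport_gradient.exists_bound_of_continuous
    hφ.continuous_gradient
  exact ⟨max C D, fun x => ⟨(hC x).trans (le_max_left _ _), (hD x).trans (le_max_right _ _)⟩⟩

theorem IsWeakGrad.congr {u u' : EuclideanSpace ℝ (Fin N) → ℝ}
    {g g' : EuclideanSpace ℝ (Fin N) → EuclideanSpace ℝ (Fin N)} (h : IsWeakGrad Ω u g)
    (hu : u =ᵐ[volume.restrict Ω] u') (hg : g =ᵐ[volume.restrict Ω] g') : IsWeakGrad Ω u' g' where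
  locInt := h.locInt.congr hu
  locInt_grad := h.locInt_grad.congr hg
  byParts φ hφ := by
    have h1 : ∫ x in Ω, u' x • gradient φ x = ∫ x in Ω, u x • gradient φ x :=
      integral_congr_ae (hu.mono fun x hx => by simp only [hx])
    have h2 : ∫ x in Ω, φ x • g' x = ∫ x in Ω, φ x • g x :=
      integral_congr_ae (hg.mono fun x hx => by simp only [hx])
    rw [h1, h2, h.byParts φ hφ]

theorem IsTestFun.integrable_smul {F : Type*} [NormedAddCommGroup F] [NormedSpace ℝ F]
    {φ : EuclideanSpace ℝ (Fin N) → ℝ} (hφ : IsTestFun Ω φ) {g : EuclideanSpace ℝ (Fin N) → F}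
    (hg : LocallyIntegrableOn g Ω volume) : Integrable (fun x => φ x • g x) := by
  have hK : IsCompact (tsupport φ) := hφ.compact
  have h1 := (hg.integrableOn_compact_subset hφ.supp hK).continuousOn_smul
    hφ.smooth.continuous.continuousOn hK
  refine (integrableOn_iff_integrable_of_support_subset ?_).1 h1
  intro x hx
  exact subset_tsupport _ fun h0 => hx (by simp [h0])

theorem IsTestFun.integrable_smul_gradient {φ : EuclideanSpace ℝ (Fin N) → ℝ}
    (hφ : IsTestFun Ω φ) {u : EuclideanSpace ℝ (Fin N) → ℝ}
    (hu : LocallyIntegrableOn u Ω volume) : Integrable (fun x => u x • gradient φ x) := by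
  have hK : IsCompact (tsupport φ) := hφ.compact
  have h1 := (hu.integrableOn_compact_subset hφ.supp hK).smul_continuousOn
    hφ.continuous_gradient.continuousOn hK
  refine (integrableOn_iff_integrable_of_support_subset ?_).1 h1
  intro x hx
  exact support_gradient_subset _ fun h0 => hx (by simp [h0])

theorem IsWeakGrad.sub {u u' : EuclideanSpace ℝ (Fin N) → ℝ}
    {g g' : EuclideanSpace ℝ (Fin N) → EuclideanSpace ℝ (Fin N)} (h : IsWeakGrad Ω u g)
    (h' : IsWeakGrad Ω u' g') : IsWeakGrad Ω (fun x => u x - u' x) (fun x => g x - g' x) where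
  locInt := h.locInt.sub h'.locInt
  locInt_grad := h.locInt_grad.sub h'.locInt_grad
  byParts φ hφ := by
    simp only [sub_smul, smul_sub]
    rw [integral_sub (hφ.integrable_smul_gradient h.locInt).integrableOn
        (hφ.integrable_smul_gradient h'.locInt).integrableOn,
      integral_sub (hφ.integrable_smul h.locInt_grad).integrableOn
        (hφ.integrable_smul h'.locInt_grad).integrableOn, h.byParts φ hφ, h'.byParts φ hφ]
    abel

/-- The fundamental lemma of the calculus of variations, applied to g - g'. It makes the choices in
`weakGrad` and `truncGrad` harmless. -/
theorem IsWeakGrad.unique (hΩ : IsOpen Ω) {u : EuclideanSpace ℝ (Fin N) → ℝ}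
    {g g' : EuclideanSpace ℝ (Fin N) → EuclideanSpace ℝ (Fin N)} (h : IsWeakGrad Ω u g)
    (h' : IsWeakGrad Ω u g') : g =ᵐ[volume.restrict Ω] g' := by
  have key := hΩ.ae_eq_zero_of_integral_contDiff_smul_eq_zero
    (h.locInt_grad.sub h'.locInt_grad) fun φ h1 h2 h3 => by
      have hφ : IsTestFun Ω φ := ⟨h1, h2, h3⟩
      have h4 := (h.sub h').byParts φ hφ
      simp only [sub_self, zero_smul, integral_zero] at h4
      rw [← setIntegral_eq_integral_of_forall_compl_eq_zero (s := Ω)]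
      · simpa using h4
      · intro x hx
        rw [image_eq_zero_of_notMem_tsupport fun h0 => hx (h3 h0), zero_smul]
  rw [Filter.EventuallyEq, ae_restrict_iff' hΩ.measurableSet]
  filter_upwards [key] with x hx hxΩ
  exact sub_eq_zero.1 (hx hxΩ)

theorem IsWeakGrad.weakGrad_ae_eq (hΩ : IsOpen Ω) {u : EuclideanSpace ℝ (Fin N) → ℝ}
    {g : EuclideanSpace ℝ (Fin N) → EuclideanSpace ℝ (Fin N)} (h : IsWeakGrad Ω u g) :
    weakGrad Ω u =ᵐ[volume.restrict Ω] g := by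
  have hex : ∃ g, IsWeakGrad Ω u g := ⟨g, h⟩
  rw [weakGrad, dif_pos hex]
  exact hex.choose_spec.unique hΩ h

/-- Weak gradients are stable under convergence in `L¹(Ω)`. -/
theorem IsWeakGrad.of_tendsto {u : EuclideanSpace ℝ (Fin N) → ℝ}
    {g : EuclideanSpace ℝ (Fin N) → EuclideanSpace ℝ (Fin N)}
    {w : ℕ → EuclideanSpace ℝ (Fin N) → ℝ}
    {G : ℕ → EuclideanSpace ℝ (Fin N) → EuclideanSpace ℝ (Fin N)}
    (hw : ∀ n, IsWeakGrad Ω (w n) (G n)) (hu : IntegrableOn u Ω) (hg : IntegrableOn g Ω)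
    (hwu : Tendsto (fun n => ∫⁻ x in Ω, ‖w n x - u x‖ₑ) atTop (𝓝 0))
    (hGg : Tendsto (fun n => ∫⁻ x in Ω, ‖G n x - g x‖ₑ) atTop (𝓝 0)) : IsWeakGrad Ω u g where
  locInt := hu.locallyIntegrableOn
  locInt_grad := hg.locallyIntegrableOn
  byParts φ hφ := by
    obtain ⟨C, hC⟩ := hφ.exists_bound
    have hC0 : 0 ≤ C := (norm_nonneg _).trans (hC 0).1
    have bound : ∀ (F : Type) [NormedAddCommGroup F] (a : ℕ → EuclideanSpace ℝ (Fin N) → F)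
        (b : ℕ → EuclideanSpace ℝ (Fin N) → ℝ≥0∞),
        (∀ n x, ‖a n x‖ₑ ≤ ENNReal.ofReal C * b n x) →
        Tendsto (fun n => ∫⁻ x in Ω, b n x) atTop (𝓝 0) →
        Tendsto (fun n => ∫⁻ x in Ω, ‖a n x‖ₑ) atTop (𝓝 0) := by
      intro F _ a b hab hb
      refine tendsto_of_tendsto_of_tendsto_of_le_of_le tendsto_const_nhds
        (h := fun n => ENNReal.ofReal C * ∫⁻ x in Ω, b n x) ?_ (fun _ => bot_le) fun n => ?_
      · simpa using ENNReal.Tendsto.const_mul hb (Or.inr ENNReal.ofReal_ne_top)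
      · simp only
        rw [← lintegral_const_mul' _ _ ENNReal.ofReal_ne_top]
        exact lintegral_mono fun x => hab n x
    have h1 : Tendsto (fun n => ∫ x in Ω, w n x • gradient φ x) atTop
        (𝓝 (∫ x in Ω, u x • gradient φ x)) := by
      refine tendsto_integral_of_L1 _
        (hφ.integrable_smul_gradient hu.locallyIntegrableOn).integrableOn.aestronglyMeasurable
        (Eventually.of_forall fun n => (hφ.integrable_smul_gradient (hw n).locInt).integrableOn)
        (bound _ _ (fun n x => ‖w n x - u x‖ₑ) (fun n x => ?_) hwu)
      rw [← sub_smul, enorm_smul, mul_comm]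
      gcongr
      rw [← ofReal_norm]
      exact ENNReal.ofReal_le_ofReal (hC x).2
    have h2 : Tendsto (fun n => ∫ x in Ω, φ x • G n x) atTop
        (𝓝 (∫ x in Ω, φ x • g x)) := by
      refine tendsto_integral_of_L1 _
        (hφ.integrable_smul hg.locallyIntegrableOn).integrableOn.aestronglyMeasurable
        (Eventually.of_forall fun n => (hφ.integrable_smul (hw n).locInt_grad).integrableOn)
        (bound _ _ (fun n x => ‖G n x - g x‖ₑ) (fun n x => ?_) hGg)
      rw [← smul_sub, enorm_smul]
      gcongr
      rw [← ofReal_norm]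
      exact ENNReal.ofReal_le_ofReal (hC x).1
    simp only [(hw _).byParts φ hφ] at h1
    exact tendsto_nhds_unique h1 h2.neg

/-- Dominated convergence supplies the L¹ limits. This form suits approximations whose derivatives
converge only pointwise, to a discontinuous limit. -/
theorem IsWeakGrad.of_tendsto_ae {u : EuclideanSpace ℝ (Fin N) → ℝ}
    {g : EuclideanSpace ℝ (Fin N) → EuclideanSpace ℝ (Fin N)}
    {w : ℕ → EuclideanSpace ℝ (Fin N) → ℝ}
    {G : ℕ → EuclideanSpace ℝ (Fin N) → EuclideanSpace ℝ (Fin N)}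
    {bw bG : EuclideanSpace ℝ (Fin N) → ℝ}
    (hw : ∀ n, IsWeakGrad Ω (w n) (G n)) (hu : IntegrableOn u Ω) (hg : IntegrableOn g Ω)
    (hwm : ∀ n, AEStronglyMeasurable (w n) (volume.restrict Ω))
    (hGm : ∀ n, AEStronglyMeasurable (G n) (volume.restrict Ω))
    (hbw : IntegrableOn bw Ω) (hbG : IntegrableOn bG Ω)
    (hwb : ∀ n, ∀ᵐ x ∂(volume.restrict Ω), ‖w n x‖ ≤ bw x)
    (hGb : ∀ n, ∀ᵐ x ∂(volume.restrict Ω), ‖G n x‖ ≤ bG x)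
    (hwu : ∀ᵐ x ∂(volume.restrict Ω), Tendsto (fun n => w n x) atTop (𝓝 (u x)))
    (hGg : ∀ᵐ x ∂(volume.restrict Ω), Tendsto (fun n => G n x) atTop (𝓝 (g x))) :
    IsWeakGrad Ω u g := by
  refine IsWeakGrad.of_tendsto hw hu hg ?_ ?_
  · simpa only [ofReal_norm] using
      tendsto_lintegral_norm_of_dominated_convergence hwm hbw.hasFiniteIntegral hwb hwu
  · simpa only [ofReal_norm] using
      tendsto_lintegral_norm_of_dominated_convergence hGm hbG.hasFiniteIntegral hGb hGg

/-- A function of class `C¹` is weakly differentiable, with its classical gradient. -/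
theorem IsWeakGrad.of_contDiff {F : EuclideanSpace ℝ (Fin N) → ℝ} (hF : ContDiff ℝ 1 F) :
    IsWeakGrad Ω F (gradient F) where
  locInt := hF.continuous.locallyIntegrable.locallyIntegrableOn _
  locInt_grad := ((InnerProductSpace.toDual ℝ _).symm.continuous.comp
    (hF.continuous_fderiv (by simp))).locallyIntegrable.locallyIntegrableOn _
  byParts φ hφ := by
    have hc : Continuous (gradient F) := (InnerProductSpace.toDual ℝ _).symm.continuous.comp
      (hF.continuous_fderiv (by simp))
    have hi1 := hφ.integrable_smul_gradient (hF.continuous.locallyIntegrable.locallyIntegrableOn Ω)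
    have hi2 := hφ.integrable_smul (hc.locallyIntegrable.locallyIntegrableOn Ω)
    have hi3 := hφ.integrable_smul (hF.continuous.locallyIntegrable.locallyIntegrableOn Ω)
    rw [setIntegral_eq_integral_of_forall_compl_eq_zero,
      setIntegral_eq_integral_of_forall_compl_eq_zero]
    -- Pairing the vector identity with a fixed v reduces it to scalar integration by parts in the
    -- direction v.
    · refine ext_inner_right ℝ fun v => ?_
      rw [inner_neg_left, real_inner_comm, real_inner_comm v, ← integral_inner hi1,
        ← integral_inner hi2]
      have h := integral_mul_fderiv_eq_neg_fderiv_mul_of_integrable (μ := volume)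
        (f := F) (g := φ) (v := v) ?_ ?_ ?_ (fun x _ => hF.differentiable (by simp) x)
        (fun x _ => hφ.smooth.differentiable (by simp) x)
      · convert! h using 1
        · simp [inner_smul_right, inner_gradient_right]
        · simp [inner_smul_right, inner_gradient_right, mul_comm]
      · convert! hi2.inner_const (𝕜 := ℝ) v using 2 with x
        simp [inner_smul_left, inner_gradient_left, mul_comm]
      · convert! hi1.inner_const (𝕜 := ℝ) v using 2 with x
        simp [inner_smul_left, inner_gradient_left]
      · convert! hi3 using 2 with x
        simp [mul_comm]
    · intro x hx
      rw [image_eq_zero_of_notMem_tsupport fun h0 => hx (hφ.supp h0), zero_smul]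
    · intro x hx
      have : gradient φ x = 0 := by
        by_contra h0
        exact hx (hφ.supp (support_gradient_subset _ h0))
      rw [this, smul_zero]

end WeakGradient

/-! ### Approximation by test functions and the C¹ chain rule -/

section SobolevZero

variable {N : ℕ} {Ω : Set (EuclideanSpace ℝ (Fin N))}

theorem Bornology.IsBounded.isFiniteMeasure_restrict (hΩb : Bornology.IsBounded Ω) :
    IsFiniteMeasure (volume.restrict Ω) :=
  ⟨by simpa using hΩb.measure_lt_top⟩

theorem tendsto_eLpNorm_one_of_tendsto_eLpNorm {F : Type*} [NormedAddCommGroup F]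
    {μ : Measure (EuclideanSpace ℝ (Fin N))} [IsFiniteMeasure μ] {q : ℝ≥0∞} (hq : 1 ≤ q)
    {f : ℕ → EuclideanSpace ℝ (Fin N) → F} (hf : ∀ n, AEStronglyMeasurable (f n) μ)
    (h : Tendsto (fun n => eLpNorm (f n) q μ) atTop (𝓝 0)) :
    Tendsto (fun n => ∫⁻ x, ‖f n x‖ₑ ∂μ) atTop (𝓝 0) := by
  simp only [← eLpNorm_one_eq_lintegral_enorm]
  have hC : μ univ ^ (1 / (1 : ℝ≥0∞).toReal - 1 / q.toReal) ≠ ⊤ := by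
    refine (ENNReal.rpow_lt_top_of_nonneg ?_ (measure_ne_top _ _)).ne
    rcases eq_or_ne q ⊤ with rfl | hq'
    · simp
    · have : 1 ≤ q.toReal := by simpa using ENNReal.toReal_mono hq' hq
      simp only [ENNReal.toReal_one, sub_nonneg]
      exact one_div_le_one_div_of_le one_pos this
  refine tendsto_of_tendsto_of_tendsto_of_le_of_le tendsto_const_nhds ?_ (fun _ => bot_le)
    fun n => eLpNorm_le_eLpNorm_mul_rpow_measure_univ hq (hf n)
  simpa using ENNReal.Tendsto.mul_const h (Or.inr hC)

theorem exists_subseq_tendsto_ae_of_tendsto_eLpNorm {F : Type*} [NormedAddCommGroup F]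
    {μ : Measure (EuclideanSpace ℝ (Fin N))} {q : ℝ≥0∞} (hq : q ≠ 0)
    {f : ℕ → EuclideanSpace ℝ (Fin N) → F} {g : EuclideanSpace ℝ (Fin N) → F}
    (hf : ∀ n, AEStronglyMeasurable (f n) μ) (hg : AEStronglyMeasurable g μ)
    (h : Tendsto (fun n => eLpNorm (fun x => f n x - g x) q μ) atTop (𝓝 0)) :
    ∃ ns : ℕ → ℕ, StrictMono ns ∧ ∀ᵐ x ∂μ, Tendsto (fun i => f (ns i) x) atTop (𝓝 (g x)) :=
  (tendstoInMeasure_of_tendsto_eLpNorm hq hf hg h).exists_seq_tendsto_ae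

theorem gradient_comp_real {ρ : ℝ → ℝ} {φ : EuclideanSpace ℝ (Fin N) → ℝ}
    {x : EuclideanSpace ℝ (Fin N)} (hρ : DifferentiableAt ℝ ρ (φ x))
    (hφ : DifferentiableAt ℝ φ x) :
    gradient (fun y => ρ (φ y)) x = deriv ρ (φ x) • gradient φ x := by
  have h := (hρ.hasDerivAt.comp_hasFDerivAt x hφ.hasFDerivAt).fderiv
  rw [gradient, gradient, ← map_smul]
  exact congrArg _ h

/-- A weak gradient of `u` together with an approximation by test functions converging in
`W^{1,1}(Ω)`, with gradients converging in `L^p(Ω)`, and almost everywhere. -/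
theorem MemW0.exists_approx (hΩb : Bornology.IsBounded Ω) {p : ℝ} (hp : 1 ≤ p)
    {u : EuclideanSpace ℝ (Fin N) → ℝ} (hu : MemW0 Ω p u) :
    ∃ g, IsWeakGrad Ω u g ∧ MemLp g (ENNReal.ofReal p) (volume.restrict Ω) ∧
    ∃ φ : ℕ → EuclideanSpace ℝ (Fin N) → ℝ, (∀ n, IsTestFun Ω (φ n)) ∧
      (∀ᵐ x ∂(volume.restrict Ω), Tendsto (fun n => φ n x) atTop (𝓝 (u x))) ∧
      Tendsto (fun n => ∫⁻ x in Ω, ‖φ n x - u x‖ₑ) atTop (𝓝 0) ∧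
      Tendsto (fun n => ∫⁻ x in Ω, ‖gradient (φ n) x - g x‖ₑ) atTop (𝓝 0) ∧
      Tendsto (fun n => eLpNorm (fun x => gradient (φ n) x - g x) (ENNReal.ofReal p)
        (volume.restrict Ω)) atTop (𝓝 0) := by
  have := hΩb.isFiniteMeasure_restrict
  obtain ⟨hum, g, hg, hgm, φ, hφ, h1, h2⟩ := hu
  have hp1 : 1 ≤ ENNReal.ofReal p := by simpa using ENNReal.ofReal_le_ofReal hp
  have hφm : ∀ n, AEStronglyMeasurable (φ n) (volume.restrict Ω) :=
    fun n => (hφ n).smooth.continuous.aestronglyMeasurable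
  obtain ⟨ns, hns, hae⟩ := exists_subseq_tendsto_ae_of_tendsto_eLpNorm
    (one_pos.trans_le hp1).ne' hφm hum.aestronglyMeasurable h1
  refine ⟨g, hg, hgm, fun n => φ (ns n), fun n => hφ _, hae, ?_, ?_,
    h2.comp hns.tendsto_atTop⟩
  · exact (tendsto_eLpNorm_one_of_tendsto_eLpNorm hp1
      (fun n => (hφm n).sub hum.aestronglyMeasurable) h1).comp hns.tendsto_atTop
  · exact (tendsto_eLpNorm_one_of_tendsto_eLpNorm hp1
      (fun n => (hφ n).continuous_gradient.aestronglyMeasurable.sub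
        hgm.aestronglyMeasurable) h2).comp hns.tendsto_atTop

/-- Chain rule for `C¹` functions with bounded derivative. -/
theorem MemW0.isWeakGrad_comp (hΩ : IsOpen Ω) (hΩb : Bornology.IsBounded Ω) {p : ℝ} (hp : 1 ≤ p)
    {u : EuclideanSpace ℝ (Fin N) → ℝ} (hu : MemW0 Ω p u)
    {g : EuclideanSpace ℝ (Fin N) → EuclideanSpace ℝ (Fin N)} (hg : IsWeakGrad Ω u g)
    {ρ : ℝ → ℝ} (hρ : ContDiff ℝ 1 ρ) (hρ1 : ∀ s, ‖deriv ρ s‖ ≤ 1) :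
    IsWeakGrad Ω (fun x => ρ (u x)) (fun x => deriv ρ (u x) • g x) := by
  have := hΩb.isFiniteMeasure_restrict
  have hp1 : 1 ≤ ENNReal.ofReal p := by simpa using ENNReal.ofReal_le_ofReal hp
  obtain ⟨g', hg', hgm, φ, hφ, hae, h1, h2, -⟩ := hu.exists_approx hΩb hp
  have hgg := hg'.unique hΩ hg
  suffices h : IsWeakGrad Ω (fun x => ρ (u x)) (fun x => deriv ρ (u x) • g' x) from
    h.congr (EventuallyEq.refl _ _) (hgg.mono fun x hx => by simp only [hx])
  have hui : IntegrableOn u Ω := hu.1.integrable hp1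
  have hgi : IntegrableOn g' Ω := hgm.integrable hp1
  have hρd : Continuous (deriv ρ) := hρ.continuous_deriv (by simp)
  have hlip : ∀ s t, ‖ρ s - ρ t‖ ≤ ‖s - t‖ := fun s t => by
    simpa using Convex.norm_image_sub_le_of_norm_deriv_le (𝕜 := ℝ) (s := univ) (C := 1)
      (fun z _ => hρ.differentiable (by simp) z) (fun z _ => hρ1 z) convex_univ
      (mem_univ t) (mem_univ s)
  have hdg : ∀ w : EuclideanSpace ℝ (Fin N) → ℝ, AEStronglyMeasurable w (volume.restrict Ω) →
      IntegrableOn (fun x => deriv ρ (w x) • g' x) Ω := fun w hw =>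
    hgi.bdd_smul 1 (hρd.comp_aestronglyMeasurable hw) (Eventually.of_forall fun x => hρ1 _)
  have hφm : ∀ n, AEStronglyMeasurable (φ n) (volume.restrict Ω) :=
    fun n => (hφ n).smooth.continuous.aestronglyMeasurable
  refine IsWeakGrad.of_tendsto (w := fun n x => ρ (φ n x))
    (G := fun n x => deriv ρ (φ n x) • gradient (φ n) x) (fun n => ?_) ?_
    (hdg u hui.aestronglyMeasurable) ?_ ?_
  · have h := IsWeakGrad.of_contDiff (Ω := Ω) (hρ.comp ((hφ n).smooth.of_le (by simp)))
    refine h.congr (EventuallyEq.refl _ _) (Eventually.of_forall fun x => ?_)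
    exact gradient_comp_real (hρ.differentiable (by simp) _)
      ((hφ n).smooth.differentiable (by simp) _)
  · have h0 : IntegrableOn (fun x => ‖ρ 0‖ + ‖u x‖) Ω :=
      (integrable_const _).add hui.norm
    refine h0.mono' (hρ.continuous.comp_aestronglyMeasurable hui.aestronglyMeasurable)
      (Eventually.of_forall fun x => ?_)
    have := hlip (u x) 0
    rw [sub_zero] at this
    exact (norm_le_norm_add_norm_sub (ρ 0) (ρ (u x))).trans (by linarith [norm_sub_rev (ρ 0) (ρ (u x))])
  · refine tendsto_of_tendsto_of_tendsto_of_le_of_le tendsto_const_nhds h1 (fun _ => bot_le)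
      fun n => lintegral_mono fun x => ?_
    simpa only [ofReal_norm] using ENNReal.ofReal_le_ofReal (hlip (φ n x) (u x))
  -- Split ρ'(φₙ)∇φₙ - ρ'(u)g' as ρ'(φₙ)(∇φₙ - g') + (ρ'(φₙ) - ρ'(u))g'. The first term is small in
  -- L¹ because |ρ'| ≤ 1, the second by dominated convergence.
  · have h3 : Tendsto (fun n => ∫⁻ x in Ω, ‖deriv ρ (φ n x) • g' x - deriv ρ (u x) • g' x‖ₑ)
        atTop (𝓝 0) := by
      simpa only [ofReal_norm] using tendsto_lintegral_norm_of_dominated_convergence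
        (bound := fun x => ‖g' x‖) (fun n => (hdg _ (hφm n)).aestronglyMeasurable)
        hgi.norm.hasFiniteIntegral
        (fun n => Eventually.of_forall fun x => by
          rw [norm_smul]
          exact mul_le_of_le_one_left (norm_nonneg _) (hρ1 _))
        (hae.mono fun x hx => ((hρd.tendsto _).comp hx).smul_const _)
    refine tendsto_of_tendsto_of_tendsto_of_le_of_le tendsto_const_nhds
      (by simpa using h2.add h3) (fun _ => bot_le) fun n => ?_
    have hm : AEMeasurable (fun x => ‖gradient (φ n) x - g' x‖ₑ) (volume.restrict Ω) :=
      ((hφ n).continuous_gradient.aestronglyMeasurable.sub hgi.aestronglyMeasurable).enorm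
    rw [← lintegral_add_left' hm]
    refine lintegral_mono fun x => ?_
    calc ‖deriv ρ (φ n x) • gradient (φ n) x - deriv ρ (u x) • g' x‖ₑ
        = ‖deriv ρ (φ n x) • (gradient (φ n) x - g' x) +
          (deriv ρ (φ n x) • g' x - deriv ρ (u x) • g' x)‖ₑ := by
            congr 1; rw [smul_sub]; abel
      _ ≤ ‖deriv ρ (φ n x) • (gradient (φ n) x - g' x)‖ₑ +
          ‖deriv ρ (φ n x) • g' x - deriv ρ (u x) • g' x‖ₑ := enorm_add_le _ _
      _ ≤ _ := by
        gcongr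
        rw [← ofReal_norm, ← ofReal_norm, norm_smul]
        exact ENNReal.ofReal_le_ofReal (mul_le_of_le_one_left (norm_nonneg _) (hρ1 _))

end SobolevZero

/-! ### Gradients of truncations and existence of ∇u -/

section Truncation

theorem hasDerivAt_sq_posPart (x : ℝ) :
    HasDerivAt (fun y : ℝ => (max y 0) ^ 2) (2 * max x 0) x := by
  rcases lt_trichotomy x 0 with hx | rfl | hx
  · rw [max_eq_right hx.le, mul_zero]
    refine (hasDerivAt_const x (0 : ℝ)).congr_of_eventuallyEq ?_
    filter_upwards [Iio_mem_nhds hx] with y hy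
    rw [max_eq_right (le_of_lt hy), zero_pow two_ne_zero]
  · rw [max_self, mul_zero, hasDerivAt_iff_isLittleO_nhds_zero]
    have h : (fun h : ℝ => h ^ 2) =o[𝓝 0] fun h : ℝ => h := by
      simpa using Asymptotics.isLittleO_pow_pow (𝕜 := ℝ) (m := 1) (n := 2) one_lt_two
    refine Asymptotics.IsBigO.trans_isLittleO (Asymptotics.isBigO_of_le _ fun y => ?_) h
    rcases le_total y 0 with hy | hy <;> simp [hy, sq_nonneg]
  · rw [max_eq_left hx.le]
    have h : HasDerivAt (fun y : ℝ => y ^ 2) (2 * x) x := by simpa using hasDerivAt_pow 2 x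
    refine h.congr_of_eventuallyEq ?_
    filter_upwards [Ioi_mem_nhds hx] with y hy
    rw [max_eq_left (le_of_lt hy)]

/-- A `C¹` approximation of `s ↦ min s j`, whose derivative is `1` on `(-∞, j]` and `0` on
`[j + e, ∞)`. -/
noncomputable def smoothMin (j e s : ℝ) : ℝ :=
  s - ((max (s - j) 0) ^ 2 - (max (s - j - e) 0) ^ 2) / (2 * e)

theorem hasDerivAt_smoothMin (j e s : ℝ) :
    HasDerivAt (smoothMin j e) (1 - (max (s - j) 0 - max (s - j - e) 0) / e) s := by
  have h1 := (hasDerivAt_sq_posPart (s - j)).comp_sub_const s j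
  have h2 := (hasDerivAt_sq_posPart (s - (j + e))).comp_sub_const s (j + e)
  have h := (hasDerivAt_id s).sub ((h1.sub h2).div_const (2 * e))
  simp only [sub_add_eq_sub_sub] at h
  convert! h using 1
  rw [← mul_sub, mul_div_mul_left _ _ two_ne_zero]

theorem deriv_smoothMin (j e s : ℝ) :
    deriv (smoothMin j e) s = 1 - (max (s - j) 0 - max (s - j - e) 0) / e :=
  (hasDerivAt_smoothMin j e s).deriv

theorem contDiff_smoothMin (j e : ℝ) : ContDiff ℝ 1 (smoothMin j e) := by
  rw [contDiff_one_iff_deriv]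
  refine ⟨fun s => (hasDerivAt_smoothMin j e s).differentiableAt, ?_⟩
  have : deriv (smoothMin j e) = fun s => 1 - (max (s - j) 0 - max (s - j - e) 0) / e :=
    funext (deriv_smoothMin j e)
  rw [this]
  fun_prop

theorem norm_deriv_smoothMin_le (j : ℝ) {e : ℝ} (he : 0 < e) (s : ℝ) :
    ‖deriv (smoothMin j e) s‖ ≤ 1 := by
  have h1 : 0 ≤ max (s - j) 0 - max (s - j - e) 0 :=
    sub_nonneg.2 (max_le_max (by linarith) le_rfl)
  have h2 : max (s - j) 0 - max (s - j - e) 0 ≤ e := by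
    have : max (s - j) 0 ≤ max (s - j - e) 0 + e :=
      max_le (by linarith [le_max_left (s - j - e) 0]) (by linarith [le_max_right (s - j - e) 0])
    linarith
  rw [deriv_smoothMin, Real.norm_eq_abs, abs_le]
  have h3 : (max (s - j) 0 - max (s - j - e) 0) / e ≤ 1 := (div_le_one he).2 h2
  have h4 : 0 ≤ (max (s - j) 0 - max (s - j - e) 0) / e := div_nonneg h1 he.le
  constructor <;> linarith

theorem smoothMin_of_le {j e s : ℝ} (he : 0 < e) (hs : s ≤ j) : smoothMin j e s = s := by
  rw [smoothMin, max_eq_right (by linarith), max_eq_right (by linarith)]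
  simp

theorem smoothMin_of_add_le {j e s : ℝ} (he : 0 < e) (hs : j + e ≤ s) :
    smoothMin j e s = j + e / 2 := by
  rw [smoothMin, max_eq_left (by linarith), max_eq_left (by linarith)]
  field_simp
  ring

theorem tendsto_smoothMin (j s : ℝ) :
    Tendsto (fun n : ℕ => smoothMin j (1 / ((n : ℝ) + 1)) s) atTop (𝓝 (min s j)) := by
  rcases le_or_gt s j with hs | hs
  · rw [min_eq_left hs]
    exact tendsto_const_nhds.congr fun n => (smoothMin_of_le Nat.one_div_pos_of_nat hs).symm
  · rw [min_eq_right hs.le]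
    have h0 := tendsto_one_div_add_atTop_nhds_zero_nat (𝕜 := ℝ)
    have h1 : Tendsto (fun n : ℕ => j + 1 / ((n : ℝ) + 1) / 2) atTop (𝓝 j) := by
      simpa using (h0.div_const 2).const_add j
    refine h1.congr' ?_
    filter_upwards [h0.eventually (Iio_mem_nhds (sub_pos.2 hs))] with n hn
    exact (smoothMin_of_add_le Nat.one_div_pos_of_nat (by linarith)).symm

/-- The transition zone [j, j+e] lies above j, so the limit is 1 at s = j as well. The closed set {u
≤ j} therefore appears directly, without knowing that the gradient vanishes a.e. on {u = j}. -/
theorem tendsto_deriv_smoothMin (j s : ℝ) :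
    Tendsto (fun n : ℕ => deriv (smoothMin j (1 / ((n : ℝ) + 1))) s) atTop
      (𝓝 (if s ≤ j then 1 else 0)) := by
  split_ifs with hs
  · refine tendsto_const_nhds.congr fun n => ?_
    rw [deriv_smoothMin, max_eq_right (by linarith),
      max_eq_right (by linarith [Nat.one_div_pos_of_nat (α := ℝ) (n := n)])]
    simp
  · rw [not_le] at hs
    refine tendsto_const_nhds.congr' ?_
    filter_upwards [(tendsto_one_div_add_atTop_nhds_zero_nat (𝕜 := ℝ)).eventually
      (Iio_mem_nhds (sub_pos.2 hs))] with n hn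
    have hpos : (0 : ℝ) < 1 / ((n : ℝ) + 1) := Nat.one_div_pos_of_nat
    rw [deriv_smoothMin, max_eq_left (by linarith), max_eq_left (by linarith)]
    field_simp
    ring

theorem norm_smoothMin_le (j : ℝ) {e : ℝ} (he : 0 < e) (s : ℝ) (hj : 0 ≤ j) :
    ‖smoothMin j e s‖ ≤ ‖s‖ := by
  have h := Convex.norm_image_sub_le_of_norm_deriv_le (𝕜 := ℝ) (s := univ) (C := 1)
    (fun z _ => (contDiff_smoothMin j e).differentiable (by simp) z)
    (fun z _ => norm_deriv_smoothMin_le j he z) convex_univ (mem_univ 0) (mem_univ s)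
  simpa [smoothMin_of_le he hj] using h

variable {N : ℕ} {Ω : Set (EuclideanSpace ℝ (Fin N))}

/-- The weak gradient of the truncation of a nonnegative function. -/
theorem MemW0.isWeakGrad_trunc (hΩ : IsOpen Ω) (hΩb : Bornology.IsBounded Ω) {p : ℝ} (hp : 1 ≤ p)
    {u : EuclideanSpace ℝ (Fin N) → ℝ} (hu : MemW0 Ω p u)
    (hu0 : ∀ᵐ x ∂(volume.restrict Ω), 0 ≤ u x)
    {g : EuclideanSpace ℝ (Fin N) → EuclideanSpace ℝ (Fin N)} (hg : IsWeakGrad Ω u g)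
    {j : ℝ} (hj : 0 < j) :
    IsWeakGrad Ω (fun x => trunc j (u x)) (fun x => (if u x ≤ j then (1 : ℝ) else 0) • g x) := by
  have := hΩb.isFiniteMeasure_restrict
  have hp1 : 1 ≤ ENNReal.ofReal p := by simpa using ENNReal.ofReal_le_ofReal hp
  have hui : IntegrableOn u Ω := hu.1.integrable hp1
  have hgi : IntegrableOn g Ω := by
    obtain ⟨-, g', hg', hgm, -⟩ := hu
    exact (hgm.integrable hp1).congr (hg'.unique hΩ hg)
  have hm : Measurable fun s : ℝ => if s ≤ j then (1 : ℝ) else 0 :=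
    Measurable.ite measurableSet_Iic measurable_const measurable_const
  have htr : (fun x => min (u x) j) =ᵐ[volume.restrict Ω] fun x => trunc j (u x) :=
    hu0.mono fun x hx => (max_eq_right (le_min (by linarith) (by linarith))).symm
  refine IsWeakGrad.congr ?_ htr (EventuallyEq.refl _ _)
  have hpos : ∀ n : ℕ, (0 : ℝ) < 1 / ((n : ℝ) + 1) := fun n => Nat.one_div_pos_of_nat
  refine IsWeakGrad.of_tendsto_ae (bw := fun x => ‖u x‖) (bG := fun x => ‖g x‖)
    (fun n => hu.isWeakGrad_comp hΩ hΩb hp hg (contDiff_smoothMin j (1 / ((n : ℝ) + 1)))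
      (norm_deriv_smoothMin_le j (hpos n))) (hui.inf (integrable_const j)) ?_ (fun n => ?_)
    (fun n => ?_) hui.norm hgi.norm (fun n => ?_) (fun n => ?_) ?_ ?_
  · refine hgi.bdd_smul 1 (hm.comp_aemeasurable hui.aemeasurable).aestronglyMeasurable
      (Eventually.of_forall fun x => ?_)
    simp only [Function.comp_apply]
    split_ifs <;> simp
  · exact (contDiff_smoothMin j _).continuous.comp_aestronglyMeasurable hui.aestronglyMeasurable
  · exact (((contDiff_smoothMin j _).continuous_deriv (by simp)).comp_aestronglyMeasurable
      hui.aestronglyMeasurable).smul hgi.aestronglyMeasurable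
  · exact Eventually.of_forall fun x => norm_smoothMin_le j (hpos n) _ hj.le
  · refine Eventually.of_forall fun x => ?_
    rw [norm_smul]
    exact mul_le_of_le_one_left (norm_nonneg _) (norm_deriv_smoothMin_le j (hpos n) _)
  · exact Eventually.of_forall fun x => tendsto_smoothMin j (u x)
  · exact Eventually.of_forall fun x => (tendsto_deriv_smoothMin j (u x)).smul_const _

theorem trunc_eq_min {k s : ℝ} (hk : 0 < k) (hs : 0 ≤ s) : trunc k s = min s k :=
  max_eq_right (le_min (by linarith) (by linarith))

theorem trunc_eq_self {k s : ℝ} (hs : |s| ≤ k) : trunc k s = s := by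
  rw [abs_le] at hs
  rw [trunc, min_eq_left hs.2, max_eq_right hs.1]

theorem continuous_trunc (k : ℝ) : Continuous (trunc k) := by
  unfold trunc
  fun_prop

/-- A nonnegative function whose truncations lie in `W^{1,p}_0(Ω)` has a gradient in the sense of
truncations. -/
theorem exists_isTruncGrad (hΩ : IsOpen Ω) (hΩb : Bornology.IsBounded Ω) {p : ℝ} (hp : 1 ≤ p)
    {u : EuclideanSpace ℝ (Fin N) → ℝ} (hu0 : ∀ᵐ x ∂(volume.restrict Ω), 0 ≤ u x)
    (hu : ∀ k : ℝ, 0 < k → MemW0 Ω p (fun x => trunc k (u x))) :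
    ∃ v, IsTruncGrad Ω u v := by
  choose hm g hg hgm _ using fun n : ℕ => hu ((n : ℝ) + 1) (by positivity)
  -- For k < n+1, T_k(T_{n+1}(u)) = T_k(u), so the gradient of every lower truncation is a
  -- restriction of g n. With uniqueness, g n and g m agree where u is below both levels.
  have hrestr : ∀ (n : ℕ) (k : ℝ), 0 < k → k < (n : ℝ) + 1 →
      IsWeakGrad Ω (fun x => trunc k (u x))
        (fun x => (if u x ≤ k then (1 : ℝ) else 0) • g n x) := by
    intro n k hk hkn
    refine ((hu ((n : ℝ) + 1) (by positivity)).isWeakGrad_trunc hΩ hΩb hp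
      (hu0.mono fun x hx => ?_) (hg n) hk).congr (hu0.mono fun x hx => ?_)
      (hu0.mono fun x hx => ?_)
    · rw [trunc_eq_min (by positivity) hx]
      positivity
    · have h1 : 0 ≤ min (u x) ((n : ℝ) + 1) := by positivity
      simp only [trunc_eq_min (show (0 : ℝ) < n + 1 by positivity) hx, trunc_eq_min hk h1,
        trunc_eq_min hk hx, min_assoc, min_eq_right hkn.le]
    · have h1 : min (u x) ((n : ℝ) + 1) ≤ k ↔ u x ≤ k := by
        simp [hkn]
      simp only [trunc_eq_min (show (0 : ℝ) < n + 1 by positivity) hx, h1]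
  have hgg : ∀ᵐ x ∂(volume.restrict Ω), ∀ n m : ℕ, n < m → u x ≤ (n : ℝ) + 1 →
      g n x = g m x := by
    rw [ae_all_iff]
    intro n
    rw [ae_all_iff]
    intro m
    by_cases hnm : n < m
    · have h := (hg n).unique hΩ (hrestr m ((n : ℝ) + 1) (by positivity) (by simpa using hnm))
      filter_upwards [h] with x hx _ hux
      rw [hx, if_pos hux, one_smul]
    · exact Eventually.of_forall fun x h => absurd h hnm
  have hv : ∀ᵐ x ∂(volume.restrict Ω), ∀ m : ℕ, ⌈u x⌉₊ ≤ m → g ⌈u x⌉₊ x = g m x := by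
    filter_upwards [hgg] with x hx m hm
    rcases hm.eq_or_lt with h | h
    · rw [← h]
    · exact hx _ _ h ((Nat.le_ceil _).trans (by linarith))
  -- At x, use the gradient of a truncation whose level ⌈u x⌉₊ + 1 exceeds u x. Since the index
  -- depends on x, measurability comes from the sequence g m x being a.e. eventually equal to this
  -- value.
  refine ⟨fun x => g ⌈u x⌉₊ x, ?_, fun k hk => ?_⟩
  · refine aestronglyMeasurable_of_tendsto_ae atTop (fun n => (hgm n).aestronglyMeasurable) ?_
    filter_upwards [hv] with x hx
    refine tendsto_const_nhds.congr' ?_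
    filter_upwards [eventually_ge_atTop ⌈u x⌉₊] with m hm using hx m hm
  · refine (hrestr ⌈k⌉₊ k hk ((Nat.le_ceil k).trans_lt (by linarith))).congr
      (EventuallyEq.refl _ _) ?_
    filter_upwards [hv, hu0] with x hx hx0
    by_cases h : u x ≤ k
    · rw [if_pos h, one_smul, indicator_of_mem (by simpa [abs_of_nonneg hx0] using h)]
      exact (hx _ (Nat.ceil_mono h)).symm
    · rw [if_neg h, zero_smul, indicator_of_notMem (by simpa [abs_of_nonneg hx0] using h)]

theorem IsTruncGrad.truncGrad {u : EuclideanSpace ℝ (Fin N) → ℝ} (h : ∃ v, IsTruncGrad Ω u v) :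
    IsTruncGrad Ω u (truncGrad Ω u) := by
  rw [_root_.truncGrad, dif_pos h]
  exact h.choose_spec

end Truncation

/-! ### Sobolev's inequality -/

section Sobolev

variable {N : ℕ} {Ω : Set (EuclideanSpace ℝ (Fin N))}

/-- The Sobolev inequality in `W^{1,p}_0(Ω)`. -/
theorem exists_sobolev_const (N : ℕ) {p : ℝ} (hp : 1 < p) (hpN : p < N) :
    ∃ C : ℝ, 0 < C ∧ ∀ Ω : Set (EuclideanSpace ℝ (Fin N)), IsOpen Ω → Bornology.IsBounded Ω →
      ∀ u g, MemW0 Ω p u → IsWeakGrad Ω u g →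
        eLpNorm u (ENNReal.ofReal (N * p / (N - p))) (volume.restrict Ω) ≤
          ENNReal.ofReal C * eLpNorm g (ENNReal.ofReal p) (volume.restrict Ω) := by
  have hp0 : 0 < p := by linarith
  have hN0 : (0 : ℝ) < N := by linarith
  set K := SNormLESNormFDerivOfEqConst ℝ (volume : Measure (EuclideanSpace ℝ (Fin N)))
    (p.toNNReal : ℝ) with hK
  -- Adding 1 only ensures that the constant is positive.
  refine ⟨(K : ℝ) + 1, by positivity, fun Ω hΩ hΩb u g hu hg => ?_⟩
  have := hΩb.isFiniteMeasure_restrict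
  obtain ⟨g', hg', hgm, φ, hφ, hae, -, -, hlim⟩ := hu.exists_approx hΩb hp.le
  rw [← eLpNorm_congr_ae (hg'.unique hΩ hg)]
  have hsupp : ∀ n, Function.support (φ n) ⊆ Ω := fun n =>
    (subset_tsupport _).trans (hφ n).supp
  have hsupp' : ∀ n, Function.support (gradient (φ n)) ⊆ Ω := fun n =>
    (support_gradient_subset _).trans (hφ n).supp
  have hsob : ∀ n, eLpNorm (φ n) (ENNReal.ofReal (N * p / (N - p))) (volume.restrict Ω) ≤
      ENNReal.ofReal (K + 1) *
        eLpNorm (gradient (φ n)) (ENNReal.ofReal p) (volume.restrict Ω) := by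
    intro n
    rw [eLpNorm_restrict_eq_of_support_subset (hsupp n),
      eLpNorm_restrict_eq_of_support_subset (hsupp' n),
      eLpNorm_congr_norm_ae (f := gradient (φ n)) (g := fderiv ℝ (φ n))
        (Eventually.of_forall fun x => norm_gradient _ _)]
    refine (eLpNorm_le_eLpNorm_fderiv_of_eq (p := p.toNNReal)
      (p' := (N * p / (N - p)).toNNReal) volume ((hφ n).smooth.of_le (by simp)) (hφ n).compact
      (by simpa using hp.le) (by simpa using hN0) ?_).trans ?_
    · have : (0 : ℝ) < N - p := by linarith
      rw [Real.coe_toNNReal _ (by positivity)]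
      simp only [NNReal.coe_inv, Real.coe_toNNReal _ hp0.le, finrank_euclideanSpace, Fintype.card_fin]
      field_simp
    · refine mul_le_mul_left (α := ℝ≥0∞) ?_ _
      rw [← ENNReal.ofReal_coe_nnreal]
      exact ENNReal.ofReal_le_ofReal (by rw [hK]; linarith)
  -- Fatou's lemma carries the left-hand side to the a.e. limit u; on the right the gradients
  -- converge in L^p.
  refine (Lp.eLpNorm_lim_le_liminf_eLpNorm
    (fun n => (hφ n).smooth.continuous.aestronglyMeasurable) u hae).trans ?_
  have hup : ∀ n, eLpNorm (φ n) (ENNReal.ofReal (N * p / (N - p))) (volume.restrict Ω) ≤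
      ENNReal.ofReal (K + 1) * (eLpNorm (fun x => gradient (φ n) x - g' x) (ENNReal.ofReal p)
        (volume.restrict Ω) + eLpNorm g' (ENNReal.ofReal p) (volume.restrict Ω)) := by
    intro n
    refine (hsob n).trans (mul_le_mul_right (α := ℝ≥0∞) ?_ _)
    have h := eLpNorm_add_le (μ := volume.restrict Ω) (p := ENNReal.ofReal p)
      (f := fun x => gradient (φ n) x - g' x) (g := g')
      ((hφ n).continuous_gradient.aestronglyMeasurable.sub hgm.aestronglyMeasurable)
      hgm.aestronglyMeasurable (by simpa using hp.le)
    convert! h using 2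
    ext1 x
    simp
  refine (liminf_le_liminf (Eventually.of_forall hup)).trans (le_of_eq ?_)
  refine Tendsto.liminf_eq ?_
  have := ENNReal.Tendsto.const_mul (a := ENNReal.ofReal (K + 1))
    (hlim.add_const (eLpNorm g' (ENNReal.ofReal p) (volume.restrict Ω)))
    (Or.inr ENNReal.ofReal_ne_top)
  simpa using this

end Sobolev

/-! ### Consequences of the growth of the truncated energies -/

section Consequences

variable {N : ℕ} {Ω : Set (EuclideanSpace ℝ (Fin N))}

theorem tendsto_eLpNorm_zero_of_dominated {F : Type*} [NormedAddCommGroup F]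
    {μ : Measure (EuclideanSpace ℝ (Fin N))} {p : ℝ} (hp : 0 < p)
    {f : ℕ → EuclideanSpace ℝ (Fin N) → F} {g : EuclideanSpace ℝ (Fin N) → F}
    (hf : ∀ n, AEStronglyMeasurable (f n) μ) (hg : MemLp g (ENNReal.ofReal p) μ)
    (hfg : ∀ n, ∀ᵐ x ∂μ, ‖f n x‖ ≤ ‖g x‖)
    (hlim : ∀ᵐ x ∂μ, Tendsto (fun n => f n x) atTop (𝓝 0)) :
    Tendsto (fun n => eLpNorm (f n) (ENNReal.ofReal p) μ) atTop (𝓝 0) := by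
  have hp0 : ENNReal.ofReal p ≠ 0 := by simpa using hp
  simp only [eLpNorm_eq_lintegral_rpow_enorm_toReal hp0 ENNReal.ofReal_ne_top,
    ENNReal.toReal_ofReal hp.le]
  have h : Tendsto (fun n => ∫⁻ x, ‖f n x‖ₑ ^ p ∂μ) atTop (𝓝 (∫⁻ _, 0 ∂μ)) := by
    refine tendsto_lintegral_of_dominated_convergence' (fun x => ‖g x‖ₑ ^ p)
      (fun n => (hf n).enorm.pow_const p) (fun n => ?_) ?_ ?_
    · filter_upwards [hfg n] with x hx
      exact ENNReal.rpow_le_rpow (by simpa using enorm_le_iff_norm_le.2 hx) hp.le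
    · have := lintegral_rpow_enorm_lt_top_of_eLpNorm_lt_top hp0 ENNReal.ofReal_ne_top hg.2
      rw [ENNReal.toReal_ofReal hp.le] at this
      exact this.ne
    · filter_upwards [hlim] with x hx
      have h1 := (ENNReal.continuous_rpow_const (y := p)).tendsto _ |>.comp hx.enorm
      simpa [Function.comp_def, hp] using h1
  rw [lintegral_zero] at h
  have h2 := (ENNReal.continuous_rpow_const (y := 1 / p)).tendsto _ |>.comp h
  simpa [Function.comp_def, hp] using h2

/-- `W^{1,p}_0(Ω)` is closed under limits in `W^{1,p}(Ω)`. -/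
theorem MemW0.of_tendsto {p : ℝ} (hp : 1 ≤ p) {u : EuclideanSpace ℝ (Fin N) → ℝ}
    {g : EuclideanSpace ℝ (Fin N) → EuclideanSpace ℝ (Fin N)}
    {w : ℕ → EuclideanSpace ℝ (Fin N) → ℝ}
    {G : ℕ → EuclideanSpace ℝ (Fin N) → EuclideanSpace ℝ (Fin N)} (hΩ : IsOpen Ω)
    (hu : MemLp u (ENNReal.ofReal p) (volume.restrict Ω)) (hug : IsWeakGrad Ω u g)
    (hg : MemLp g (ENNReal.ofReal p) (volume.restrict Ω)) (hw : ∀ n, MemW0 Ω p (w n))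
    (hwG : ∀ n, IsWeakGrad Ω (w n) (G n))
    (hwu : Tendsto (fun n => eLpNorm (fun x => w n x - u x) (ENNReal.ofReal p)
      (volume.restrict Ω)) atTop (𝓝 0))
    (hGg : Tendsto (fun n => eLpNorm (fun x => G n x - g x) (ENNReal.ofReal p)
      (volume.restrict Ω)) atTop (𝓝 0)) : MemW0 Ω p u := by
  have hp1 : 1 ≤ ENNReal.ofReal p := by simpa using ENNReal.ofReal_le_ofReal hp
  -- Diagonal argument: choose a test function within 1/(n+1) of w n, for both the functions and the
  -- gradients.
  have happ : ∀ n : ℕ, ∃ φ, IsTestFun Ω φ ∧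
      eLpNorm (fun x => φ x - w n x) (ENNReal.ofReal p) (volume.restrict Ω) ≤
        ENNReal.ofReal (1 / ((n : ℝ) + 1)) ∧
      eLpNorm (fun x => gradient φ x - G n x) (ENNReal.ofReal p) (volume.restrict Ω) ≤
        ENNReal.ofReal (1 / ((n : ℝ) + 1)) := by
    intro n
    obtain ⟨-, g', hg', -, φ, hφ, h1, h2⟩ := hw n
    have hpos : 0 < ENNReal.ofReal (1 / ((n : ℝ) + 1)) :=
      ENNReal.ofReal_pos.2 Nat.one_div_pos_of_nat
    obtain ⟨m, hm1, hm2⟩ := ((h1.eventually (Iio_mem_nhds hpos)).and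
      (h2.eventually (Iio_mem_nhds hpos))).exists
    refine ⟨φ m, hφ m, le_of_lt hm1, le_trans (le_of_eq ?_) (le_of_lt hm2)⟩
    refine eLpNorm_congr_ae ?_
    filter_upwards [hg'.unique hΩ (hwG n)] with x hx
    rw [hx]
  choose φ hφ h1 h2 using happ
  have h0 : Tendsto (fun n : ℕ => ENNReal.ofReal (1 / ((n : ℝ) + 1))) atTop (𝓝 0) := by
    simpa using ENNReal.tendsto_ofReal (tendsto_one_div_add_atTop_nhds_zero_nat (𝕜 := ℝ))
  have hGm : ∀ n, AEStronglyMeasurable (G n) (volume.restrict Ω) := fun n => by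
    obtain ⟨-, g', hg', hm, -⟩ := hw n
    exact hm.aestronglyMeasurable.congr (hg'.unique hΩ (hwG n))
  refine ⟨hu, g, hug, hg, φ, hφ, ?_, ?_⟩
  · refine tendsto_of_tendsto_of_tendsto_of_le_of_le tendsto_const_nhds
      (by simpa using h0.add hwu) (fun _ => bot_le) fun n => ?_
    have h := eLpNorm_add_le (μ := volume.restrict Ω) (f := fun x => φ n x - w n x)
      (g := fun x => w n x - u x)
      ((hφ n).smooth.continuous.aestronglyMeasurable.sub (hw n).1.aestronglyMeasurable)
      ((hw n).1.aestronglyMeasurable.sub hu.aestronglyMeasurable) hp1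
    refine le_trans (le_of_eq ?_) (h.trans (by simpa using add_le_add_left (h1 n) _))
    congr 1
    ext1 x
    simp
  · refine tendsto_of_tendsto_of_tendsto_of_le_of_le tendsto_const_nhds
      (by simpa using h0.add hGg) (fun _ => bot_le) fun n => ?_
    have h := eLpNorm_add_le (μ := volume.restrict Ω) (f := fun x => gradient (φ n) x - G n x)
      (g := fun x => G n x - g x)
      ((hφ n).continuous_gradient.aestronglyMeasurable.sub (hGm n))
      ((hGm n).sub hg.aestronglyMeasurable) hp1
    refine le_trans (le_of_eq ?_) (h.trans (by simpa using add_le_add_left (h2 n) _))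
    congr 1
    ext1 x
    simp

theorem IsTruncGrad.memLp_indicator (hΩ : IsOpen Ω) {p : ℝ} {u : EuclideanSpace ℝ (Fin N) → ℝ}
    {v : EuclideanSpace ℝ (Fin N) → EuclideanSpace ℝ (Fin N)} (hv : IsTruncGrad Ω u v)
    {k : ℝ} (hk : 0 < k) (hu : MemW0 Ω p (fun x => trunc k (u x))) :
    MemLp (indicator {x | |u x| ≤ k} v) (ENNReal.ofReal p) (volume.restrict Ω) := by
  obtain ⟨-, g, hg, hgm, -⟩ := hu
  exact hgm.ae_eq (hg.unique hΩ (hv.trunc_grad k hk))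

theorem le_norm_trunc {k s : ℝ} (hk : 0 < k) (hs : k ≤ |s|) : k ≤ ‖trunc k s‖ := by
  simp only [Real.norm_eq_abs, trunc]
  grind

theorem norm_trunc_sub_le {k : ℝ} (hk : 0 < k) (s : ℝ) : ‖trunc k s - s‖ ≤ ‖s‖ := by
  simp only [Real.norm_eq_abs, trunc]
  grind

theorem tendsto_trunc (s : ℝ) : Tendsto (fun n : ℕ => trunc ((n : ℝ) + 1) s) atTop (𝓝 s) := by
  refine tendsto_const_nhds.congr' ?_
  filter_upwards [eventually_ge_atTop ⌈|s|⌉₊] with n hn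
  have h1 : |s| ≤ n := (Nat.le_ceil _).trans (by exact_mod_cast hn)
  exact (trunc_eq_self (by linarith)).symm

theorem tendsto_indicator_le {F : Type*} [NormedAddCommGroup F]
    (u : EuclideanSpace ℝ (Fin N) → ℝ) (v : EuclideanSpace ℝ (Fin N) → F)
    (x : EuclideanSpace ℝ (Fin N)) :
    Tendsto (fun n : ℕ => indicator {x | |u x| ≤ (n : ℝ) + 1} v x) atTop (𝓝 (v x)) := by
  refine tendsto_const_nhds.congr' ?_
  filter_upwards [eventually_ge_atTop ⌈|u x|⌉₊] with n hn
  have h1 : |u x| ≤ n := (Nat.le_ceil _).trans (by exact_mod_cast hn)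
  have h2 : x ∈ {x | |u x| ≤ (n : ℝ) + 1} := by
    rw [mem_ofPred_eq]
    linarith
  exact (indicator_of_mem h2 v).symm

/-- A function whose truncations are bounded in `W^{1,p}_0(Ω)` belongs to `W^{1,p}_0(Ω)`. -/
theorem IsTruncGrad.memW0_of_bound (hΩ : IsOpen Ω) (hΩb : Bornology.IsBounded Ω) {p : ℝ}
    (hp : 1 < p) (hpN : p < N) {u : EuclideanSpace ℝ (Fin N) → ℝ}
    {v : EuclideanSpace ℝ (Fin N) → EuclideanSpace ℝ (Fin N)} (hv : IsTruncGrad Ω u v)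
    (hum : AEStronglyMeasurable u (volume.restrict Ω))
    (hu : ∀ k : ℝ, 0 < k → MemW0 Ω p (fun x => trunc k (u x))) {C : ℝ}
    (hC : ∀ k : ℝ, 1 ≤ k → eLpNorm (indicator {x | |u x| ≤ k} v) (ENNReal.ofReal p)
      (volume.restrict Ω) ≤ ENNReal.ofReal C) : MemW0 Ω p u := by
  have := hΩb.isFiniteMeasure_restrict
  have hp1 : 1 ≤ ENNReal.ofReal p := by simpa using ENNReal.ofReal_le_ofReal hp.le
  have hn0 : ∀ n : ℕ, (0 : ℝ) < n + 1 := fun n => by positivity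
  have hn1 : ∀ n : ℕ, (1 : ℝ) ≤ n + 1 := fun n => by simp
  have hvn : ∀ n : ℕ, MemLp (indicator {x | |u x| ≤ (n : ℝ) + 1} v) (ENNReal.ofReal p)
      (volume.restrict Ω) := fun n => hv.memLp_indicator hΩ (hn0 n) (hu _ (hn0 n))
  have hvp : MemLp v (ENNReal.ofReal p) (volume.restrict Ω) := by
    refine ⟨hv.meas, lt_of_le_of_lt (Lp.eLpNorm_lim_le_liminf_eLpNorm
      (fun n => (hvn n).aestronglyMeasurable) v
      (Eventually.of_forall (tendsto_indicator_le u v))) ?_⟩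
    refine lt_of_le_of_lt (liminf_le_liminf (Eventually.of_forall fun n => hC _ (hn1 n))) ?_
    simp
  obtain ⟨K, hK0, hK⟩ := exists_sobolev_const N hp hpN
  -- Sobolev bounds the truncations uniformly in L^q with q = Np/(N-p), and Fatou passes this to u.
  -- As q ≥ p and Ω has finite measure, u is in L^p.
  have hup : MemLp u (ENNReal.ofReal p) (volume.restrict Ω) := by
    have h1 : MemLp u (ENNReal.ofReal (N * p / (N - p))) (volume.restrict Ω) := by
      refine ⟨hum, lt_of_le_of_lt (Lp.eLpNorm_lim_le_liminf_eLpNorm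
        (f := fun n x => trunc ((n : ℝ) + 1) (u x))
        (fun n => (continuous_trunc _).comp_aestronglyMeasurable hum) u
        (Eventually.of_forall fun x => tendsto_trunc (u x))) ?_⟩
      refine lt_of_le_of_lt (liminf_le_liminf (Eventually.of_forall fun n =>
        (hK Ω hΩ hΩb _ _ (hu _ (hn0 n)) (hv.trunc_grad _ (hn0 n))).trans
          (mul_le_mul_right (α := ℝ≥0∞) (hC _ (hn1 n)) _))) ?_
      simpa using ENNReal.mul_lt_top ENNReal.ofReal_lt_top ENNReal.ofReal_lt_top
    refine h1.mono_exponent (ENNReal.ofReal_le_ofReal ?_)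
    have : (0 : ℝ) < N - p := by linarith
    rw [le_div_iff₀ this]
    nlinarith
  have hdu : Tendsto (fun n : ℕ => eLpNorm (fun x => trunc ((n : ℝ) + 1) (u x) - u x)
      (ENNReal.ofReal p) (volume.restrict Ω)) atTop (𝓝 0) := by
    refine tendsto_eLpNorm_zero_of_dominated (by linarith)
      (fun n => ((continuous_trunc _).comp_aestronglyMeasurable hum).sub hum) hup
      (fun n => Eventually.of_forall fun x => norm_trunc_sub_le (hn0 n) _)
      (Eventually.of_forall fun x => ?_)
    simpa using (tendsto_trunc (u x)).sub_const (u x)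
  have hdv : Tendsto (fun n : ℕ => eLpNorm
      (fun x => indicator {x | |u x| ≤ (n : ℝ) + 1} v x - v x)
      (ENNReal.ofReal p) (volume.restrict Ω)) atTop (𝓝 0) := by
    refine tendsto_eLpNorm_zero_of_dominated (by linarith)
      (fun n => (hvn n).aestronglyMeasurable.sub hvp.aestronglyMeasurable) hvp
      (fun n => Eventually.of_forall fun x => ?_) (Eventually.of_forall fun x => ?_)
    · by_cases h : x ∈ {x | |u x| ≤ (n : ℝ) + 1} <;> simp only [indicator, h] <;> simp
    · simpa using (tendsto_indicator_le u v x).sub_const (v x)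
  have huv : IsWeakGrad Ω u v :=
    IsWeakGrad.of_tendsto (fun n => hv.trunc_grad _ (hn0 n)) (hup.integrable hp1)
      (hvp.integrable hp1)
      (tendsto_eLpNorm_one_of_tendsto_eLpNorm hp1
        (fun n => ((continuous_trunc _).comp_aestronglyMeasurable hum).sub hum) hdu)
      (tendsto_eLpNorm_one_of_tendsto_eLpNorm hp1
        (fun n => (hvn n).aestronglyMeasurable.sub hvp.aestronglyMeasurable) hdv)
  exact MemW0.of_tendsto hp.le hΩ hup huv hvp (fun n => hu _ (hn0 n))
    (fun n => hv.trunc_grad _ (hn0 n)) hdu hdv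

/-- Chebyshev's inequality for the `L^q` norm. -/
theorem measure_ge_le_of_eLpNorm_le {F : Type*} [NormedAddCommGroup F]
    {μ : Measure (EuclideanSpace ℝ (Fin N))} {q : ℝ} (hq : 0 < q)
    {f : EuclideanSpace ℝ (Fin N) → F} (hf : AEStronglyMeasurable f μ) {B : ℝ} (hB : 0 ≤ B)
    (hfB : eLpNorm f (ENNReal.ofReal q) μ ≤ ENNReal.ofReal B) {l : ℝ} (hl : 0 < l) :
    μ {x | l ≤ ‖f x‖} ≤ ENNReal.ofReal ((B / l) ^ q) := by
  have hl' : ENNReal.ofReal l ≠ 0 := by simpa using hl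
  have h := meas_ge_le_mul_pow_eLpNorm_enorm μ (p := ENNReal.ofReal q) (by simpa using hq)
    ENNReal.ofReal_ne_top hf hl' (fun h => absurd h ENNReal.ofReal_ne_top)
  rw [ENNReal.toReal_ofReal hq.le] at h
  refine le_trans (measure_mono fun x hx => ?_) (h.trans ?_)
  · rw [mem_ofPred_eq, ← ofReal_norm]
    exact ENNReal.ofReal_le_ofReal hx
  · rw [← ENNReal.mul_rpow_of_nonneg _ _ hq.le, ← ENNReal.ofReal_rpow_of_nonneg
      (by positivity) hq.le, ENNReal.ofReal_div_of_pos hl, div_eq_mul_inv, mul_comm]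
    gcongr

/-- Levels l ≤ 1 cost nothing: there |Ω| ≤ |Ω| / l^s. -/
theorem memMarcinkiewicz_of_one_le (hΩ : MeasurableSet Ω) (hΩb : Bornology.IsBounded Ω) {s : ℝ}
    (hs : 0 < s) {w : EuclideanSpace ℝ (Fin N) → ℝ}
    (hw : AEStronglyMeasurable w (volume.restrict Ω)) {c : ℝ} (hc : 0 ≤ c)
    (h : ∀ l : ℝ, 1 ≤ l → (volume.restrict Ω) {x | l < |w x|} ≤ ENNReal.ofReal (c / l ^ s)) :
    MemMarcinkiewicz Ω s w := by
  have := hΩb.isFiniteMeasure_restrict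
  set M := ((volume.restrict Ω) univ).toReal
  have hM : 0 ≤ M := ENNReal.toReal_nonneg
  refine ⟨hs, hw, c + M + 1, by positivity, fun l hl => ?_⟩
  have hset : {x | x ∈ Ω ∧ l < |w x|} = {x | l < |w x|} ∩ Ω := by
    ext x; simp [and_comm]
  rw [hset, ← Measure.restrict_apply' hΩ]
  have hls : 0 < l ^ s := Real.rpow_pos_of_pos hl s
  rcases le_total 1 l with h1 | h1
  · refine (h l h1).trans (ENNReal.ofReal_le_ofReal ?_)
    gcongr
    linarith
  · refine (measure_mono (subset_univ _)).trans ?_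
    rw [← ENNReal.ofReal_toReal (measure_ne_top (volume.restrict Ω) univ)]
    refine ENNReal.ofReal_le_ofReal ?_
    rw [le_div_iff₀ hls]
    have := Real.rpow_le_one hl.le h1 hs.le
    nlinarith

/-- Growth of the energy of the truncations gives a Marcinkiewicz estimate on the function. -/
theorem IsTruncGrad.measure_lt_le (hΩ : IsOpen Ω) (hΩb : Bornology.IsBounded Ω) {p : ℝ}
    (hp : 1 < p) (hpN : p < N) {u : EuclideanSpace ℝ (Fin N) → ℝ}
    {v : EuclideanSpace ℝ (Fin N) → EuclideanSpace ℝ (Fin N)} (hv : IsTruncGrad Ω u v)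
    (hum : AEStronglyMeasurable u (volume.restrict Ω))
    (hu : ∀ k : ℝ, 0 < k → MemW0 Ω p (fun x => trunc k (u x))) {C σ : ℝ} (hC0 : 0 ≤ C)
    (hC : ∀ k : ℝ, 1 ≤ k → eLpNorm (indicator {x | |u x| ≤ k} v) (ENNReal.ofReal p)
      (volume.restrict Ω) ≤ ENNReal.ofReal (C * k ^ (σ / p))) :
    ∃ c : ℝ, 0 ≤ c ∧ ∀ l : ℝ, 1 ≤ l → (volume.restrict Ω) {x | l < |u x|} ≤
      ENNReal.ofReal (c / l ^ (N * (p - σ) / (N - p))) := by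
  obtain ⟨K, hK0, hK⟩ := exists_sobolev_const N hp hpN
  have hNp : (0 : ℝ) < N - p := by linarith
  have hN : (0 : ℝ) < N := by linarith
  have hp0 : 0 < p := by linarith
  have hq : 0 < N * p / (N - p) := by positivity
  refine ⟨(K * C) ^ (N * p / (N - p)), by positivity, fun l hl => ?_⟩
  have hl0 : 0 < l := by linarith
  have h1 := (hK Ω hΩ hΩb _ _ (hu l hl0) (hv.trunc_grad l hl0)).trans
    (mul_le_mul_right (α := ℝ≥0∞) (hC l hl) _)
  rw [← ENNReal.ofReal_mul hK0.le] at h1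
  -- Chebyshev with exponent q = Np/(N-p) gives (K C l^{σ/p} / l)^q, and q(1 - σ/p) = N(p-σ)/(N-p).
  have h2 := measure_ge_le_of_eLpNorm_le hq
    ((continuous_trunc l).comp_aestronglyMeasurable hum) (by positivity) h1 hl0
  refine le_trans (measure_mono fun x hx => ?_) (h2.trans (le_of_eq ?_))
  · have hx' : l < |u x| := hx
    exact le_norm_trunc hl0 hx'.le
  · congr 1
    rw [← mul_assoc, mul_div_assoc, Real.mul_rpow (by positivity) (by positivity),
      div_eq_mul_inv _ (l ^ (_ : ℝ)), ← Real.rpow_neg hl0.le]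
    congr 1
    rw [← Real.rpow_sub_one hl0.ne', ← Real.rpow_mul hl0.le]
    congr 1
    field_simp
    ring

/-- Growth of the energy of the truncations gives a Marcinkiewicz estimate on the gradient. -/
theorem IsTruncGrad.measure_norm_lt_le (hΩ : IsOpen Ω) {p : ℝ}
    (hp : 0 < p) {u : EuclideanSpace ℝ (Fin N) → ℝ}
    {v : EuclideanSpace ℝ (Fin N) → EuclideanSpace ℝ (Fin N)} (hv : IsTruncGrad Ω u v)
    (hu : ∀ k : ℝ, 0 < k → MemW0 Ω p (fun x => trunc k (u x))) {C c σ t : ℝ} (hC0 : 0 ≤ C)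
    (hC : ∀ k : ℝ, 1 ≤ k → eLpNorm (indicator {x | |u x| ≤ k} v) (ENNReal.ofReal p)
      (volume.restrict Ω) ≤ ENNReal.ofReal (C * k ^ (σ / p)))
    (hc0 : 0 ≤ c) (hc : ∀ l : ℝ, 1 ≤ l → (volume.restrict Ω) {x | l < |u x|} ≤
      ENNReal.ofReal (c / l ^ t)) (hσ : 0 ≤ σ) (ht : 0 < t) {l : ℝ} (hl : 1 ≤ l) :
    (volume.restrict Ω) {x | l < ‖v x‖} ≤ ENNReal.ofReal ((c + C ^ p) / l ^ (p * t / (t + σ))) := by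
  have hl0 : 0 < l := by linarith
  have hts : 0 < t + σ := by linarith
  -- This level balances the two contributions: k^{-t} = l^{-p} k^σ = l^{-pt/(t+σ)}.
  set k := l ^ (p / (t + σ)) with hk
  have hk1 : 1 ≤ k := Real.one_le_rpow hl (by positivity)
  have hk0 : 0 < k := by linarith
  have h1 := measure_ge_le_of_eLpNorm_le hp
    (hv.memLp_indicator hΩ hk0 (hu k hk0)).aestronglyMeasurable (by positivity) (hC k hk1) hl0
  have h2 : {x | l < ‖v x‖} ⊆ {x | k < |u x|} ∪ {x | l ≤ ‖indicator {x | |u x| ≤ k} v x‖} := by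
    intro x hx
    by_cases h : |u x| ≤ k
    · right
      rw [mem_ofPred_eq, indicator_of_mem (by exact h)]
      exact le_of_lt hx
    · exact Or.inl (not_le.1 h)
  refine (measure_mono h2).trans ((measure_union_le _ _).trans
    ((add_le_add (hc k hk1) h1).trans (le_of_eq ?_)))
  rw [← ENNReal.ofReal_add (by positivity) (by positivity), add_div]
  congr 2
  · rw [hk, ← Real.rpow_mul hl0.le]
    congr 2
    ring
  · rw [mul_div_assoc, Real.mul_rpow hC0 (by positivity), div_eq_mul_inv _ (l ^ (_ : ℝ)),
      ← Real.rpow_neg hl0.le]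
    congr 1
    rw [hk, ← Real.rpow_mul hl0.le, ← Real.rpow_sub_one hl0.ne', ← Real.rpow_mul hl0.le]
    congr 1
    field_simp
    ring

end Consequences

/-! ### Energy estimates from the entropy inequality -/

section Energy

variable {N : ℕ} {Ω : Set (EuclideanSpace ℝ (Fin N))} {p : ℝ}
  {a : EuclideanSpace ℝ (Fin N) → ℝ → EuclideanSpace ℝ (Fin N) → EuclideanSpace ℝ (Fin N)}
  {h : ℝ → ℝ≥0∞} {f u : EuclideanSpace ℝ (Fin N) → ℝ}

theorem IsEntropySolution.isTruncGrad (hΩ : IsOpen Ω) (hΩb : Bornology.IsBounded Ω) (hp : 1 < p)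
    (hu : IsEntropySolution Ω p a h f u) : IsTruncGrad Ω u (truncGrad Ω u) :=
  IsTruncGrad.truncGrad (exists_isTruncGrad hΩ hΩb hp.le hu.nonneg hu.trunc_mem)

theorem trunc_sub_trunc {m k s : ℝ} (hm : 0 < m) (hk : 0 < k) (hs : 0 ≤ s) :
    trunc k (s - trunc m s) = trunc (m + k) s - trunc m s := by
  simp only [trunc]
  grind

/-- The gradient of `T_k(u - T_m(u))` is `∇u` on `{m < u ≤ m + k}` and zero elsewhere. -/
theorem IsTruncGrad.weakGrad_trunc_sub_trunc (hΩ : IsOpen Ω)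
    {v : EuclideanSpace ℝ (Fin N) → EuclideanSpace ℝ (Fin N)} (hv : IsTruncGrad Ω u v)
    (hu0 : ∀ᵐ x ∂(volume.restrict Ω), 0 ≤ u x) {m k : ℝ} (hm : 0 < m) (hk : 0 < k) :
    weakGrad Ω (fun y => trunc k (u y - trunc m (u y))) =ᵐ[volume.restrict Ω]
      indicator {x | m < u x ∧ u x ≤ m + k} v := by
  refine IsWeakGrad.weakGrad_ae_eq hΩ
    (((hv.trunc_grad (m + k) (by linarith)).sub (hv.trunc_grad m hm)).congr ?_ ?_)
  · exact hu0.mono fun x hx => (trunc_sub_trunc hm hk hx).symm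
  · filter_upwards [hu0] with x hx
    simp only [indicator, mem_ofPred_eq, abs_of_nonneg hx]
    by_cases h1 : u x ≤ m
    · simp [h1, h1.trans (le_add_of_nonneg_right hk.le)]
    · simp [h1, not_le.1 h1]

theorem integrable_inner_of_memLp {μ : Measure (EuclideanSpace ℝ (Fin N))} (hp : 1 < p)
    {w z : EuclideanSpace ℝ (Fin N) → EuclideanSpace ℝ (Fin N)}
    (hw : MemLp w (ENNReal.ofReal (p / (p - 1))) μ) (hz : MemLp z (ENNReal.ofReal p) μ) :
    Integrable (fun x => inner ℝ (w x) (z x)) μ := by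
  have : ENNReal.HolderConjugate (ENNReal.ofReal (p / (p - 1))) (ENNReal.ofReal p) :=
    ((Real.holderConjugate_iff_eq_conjExponent hp).2 rfl).symm.ennrealOfReal
  refine (hw.norm.integrable_mul hz.norm).mono'
    (hw.aestronglyMeasurable.inner hz.aestronglyMeasurable) (Eventually.of_forall fun x => ?_)
  exact norm_inner_le_norm _ _

variable {α τ γ c₂ s₂ : ℝ}

/-- On {u > m} with m > 0, the weight u^{-γ} is bounded by m^{-γ}, so integrability of f suffices.
-/
theorem integrable_indicator_source {μ : Measure (EuclideanSpace ℝ (Fin N))}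
    (hγ : 0 ≤ γ) (hf : Integrable f μ)
    (hum : AEStronglyMeasurable u μ) {m : ℝ} (hm : 0 < m) :
    Integrable (indicator {x | m < u x} fun x => c₂ / u x ^ γ * f x) μ := by
  have hmeas : Measurable (indicator (Ioi m) fun s : ℝ => c₂ / s ^ γ) := by
    refine Measurable.indicator ?_ measurableSet_Ioi
    fun_prop
  have h1 : AEStronglyMeasurable (fun x => indicator (Ioi m) (fun s : ℝ => c₂ / s ^ γ) (u x)) μ :=
    (hmeas.comp_aemeasurable hum.aemeasurable).aestronglyMeasurable
  refine (hf.bdd_mul (c := |c₂| / m ^ γ) h1 (Eventually.of_forall fun x => ?_)).congr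
    (Eventually.of_forall fun x => ?_)
  · by_cases hx : u x ∈ Ioi m
    · have hx' : m < u x := hx
      have hux : 0 < u x := hm.trans hx'
      rw [indicator_of_mem hx, Real.norm_eq_abs, abs_div, abs_of_pos (Real.rpow_pos_of_pos hux γ)]
      gcongr
    · rw [indicator_of_notMem hx, norm_zero]
      positivity
  · by_cases hx : m < u x <;> simp [indicator, hx]

/-- The energy on a slice `{m < u ≤ m + 1}`, from the test function `T_m(u)`. -/
theorem IsEntropySolution.slice_energy_le (hΩ : IsOpen Ω) (hΩb : Bornology.IsBounded Ω)
    (hp : 1 < p) (hγ : 0 ≤ γ) {b : ℝ → ℝ} (hα : 0 < α) (hτ : 0 ≤ τ)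
    (hbα : ∀ s : ℝ, α / (1 + |s|) ^ τ ≤ b s)
    (hab : ∀ᵐ x ∂(volume.restrict Ω), ∀ (s : ℝ) (ξ : EuclideanSpace ℝ (Fin N)),
      b s * ‖ξ‖ ^ p ≤ inner ℝ (a x s ξ) ξ)
    (hc₂ : 0 < c₂) (hh₂ : ∀ s : ℝ, s₂ ≤ s → h s ≤ ENNReal.ofReal (c₂ / s ^ γ))
    (hf : Integrable f (volume.restrict Ω)) (hf0 : ∀ᵐ x ∂(volume.restrict Ω), 0 ≤ f x)
    (hu : IsEntropySolution Ω p a h f u) {m : ℝ} (hm : 0 < m) (hms : s₂ ≤ m) :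
    ∫ x in Ω, indicator {x | m < u x ∧ u x ≤ m + 1} (fun x => ‖truncGrad Ω u x‖ ^ p) x ≤
      (2 + m) ^ τ / α * ∫ x in Ω, indicator {x | m < u x} (fun x => c₂ / u x ^ γ * f x) x := by
  have := hΩb.isFiniteMeasure_restrict
  have hv := hu.isTruncGrad hΩ hΩb hp
  set v := truncGrad Ω u with hvdef
  have hm1 : 0 < m + 1 := by linarith
  have hum := hu.meas
  have hbdd : MemLp (fun x => trunc m (u x)) ⊤ (volume.restrict Ω) := by
    refine MemLp.of_bound ((continuous_trunc m).comp_aestronglyMeasurable hum) m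
      (Eventually.of_forall fun x => ?_)
    simp only [Real.norm_eq_abs, trunc]
    grind
  have hent := hu.entropy 1 one_pos _ (hu.trunc_mem m hm) hbdd
  have hslice := hv.weakGrad_trunc_sub_trunc hΩ hu.nonneg hm one_pos
  have hgrad := (hv.trunc_grad (m + 1) hm1).weakGrad_ae_eq hΩ
  have hS : MemLp (indicator {x | m < u x ∧ u x ≤ m + 1} v) (ENNReal.ofReal p)
      (volume.restrict Ω) := by
    have h1 := (hv.memLp_indicator hΩ hm1 (hu.trunc_mem _ hm1)).sub
      (hv.memLp_indicator hΩ hm (hu.trunc_mem _ hm))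
    refine h1.ae_eq ?_
    filter_upwards [hu.nonneg] with x hx
    simp only [Pi.sub_apply, indicator, mem_ofPred_eq, abs_of_nonneg hx]
    by_cases h1 : u x ≤ m
    · simp [h1, h1.trans (le_add_of_nonneg_right zero_le_one)]
    · simp [h1, not_le.1 h1]
  -- Integrability is indispensable: the Bochner integral of a non-integrable function is 0, which
  -- would void the coercivity bound. `flux_mem` concerns T_{m+1}(u), which equals u on the slice;
  -- off the slice the pairing vanishes.
  have hI := integrable_inner_of_memLp hp (hu.flux_mem (m + 1) hm1) hS
  have hIeq : (fun x => inner ℝ (a x (trunc (m + 1) (u x))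
        (weakGrad Ω (fun y => trunc (m + 1) (u y)) x))
        (indicator {x | m < u x ∧ u x ≤ m + 1} v x)) =ᵐ[volume.restrict Ω]
      fun x => inner ℝ (a x (u x) (v x))
        (weakGrad Ω (fun y => trunc 1 (u y - trunc m (u y))) x) := by
    filter_upwards [hslice, hgrad, hu.nonneg] with x h1 h2 h3
    rw [h1, h2]
    by_cases hx : m < u x ∧ u x ≤ m + 1
    · have hle : |u x| ≤ m + 1 := by rw [abs_of_nonneg h3]; exact hx.2
      have e : indicator {x | |u x| ≤ m + 1} v x = v x :=
        indicator_of_mem (by rw [mem_ofPred_eq]; exact hle) v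
      rw [trunc_eq_self hle, e]
    · have e : indicator {x | m < u x ∧ u x ≤ m + 1} v x = 0 :=
        indicator_of_notMem (by rw [mem_ofPred_eq]; exact hx) v
      rw [e, inner_zero_right, inner_zero_right]
  -- The factor T_1(u - T_m(u)) lies in [0, 1] and vanishes on {u ≤ m}; where u > m ≥ s₂ the decay
  -- of h applies.
  have hsrc : ∫ x in Ω, (source h f u x).toReal * trunc 1 (u x - trunc m (u x)) ≤
      ∫ x in Ω, indicator {x | m < u x} (fun x => c₂ / u x ^ γ * f x) x := by
    refine integral_mono_of_nonneg ?_ (integrable_indicator_source hγ hf hum hm) ?_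
    · filter_upwards [hu.nonneg] with x hx
      refine mul_nonneg ENNReal.toReal_nonneg ?_
      simp only [trunc]
      grind
    · filter_upwards [hu.nonneg, hf0] with x hx hfx
      by_cases hmx : m < u x
      · rw [indicator_of_mem (by rw [mem_ofPred_eq]; exact hmx)]
        have h1 : (source h f u x).toReal ≤ c₂ / u x ^ γ * f x := by
          have h0 : 0 ≤ c₂ / u x ^ γ * f x := by positivity
          rw [← ENNReal.toReal_ofReal h0, ENNReal.ofReal_mul (by positivity)]
          refine ENNReal.toReal_mono
            (ENNReal.mul_ne_top ENNReal.ofReal_ne_top ENNReal.ofReal_ne_top) ?_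
          exact mul_le_mul_left (α := ℝ≥0∞) (hh₂ _ (hms.trans hmx.le)) _
        have h2 : trunc 1 (u x - trunc m (u x)) ≤ 1 := by
          simp only [trunc]
          grind
        have h3 := mul_le_mul_of_nonneg_left h2
          (ENNReal.toReal_nonneg (a := source h f u x))
        linarith
      · rw [indicator_of_notMem (by rw [mem_ofPred_eq]; exact hmx)]
        have h2 : trunc 1 (u x - trunc m (u x)) = 0 := by
          simp only [trunc]
          grind
        simp only [h2, mul_zero, le_refl]
  have hlow : ∫ x in Ω, α / (2 + m) ^ τ *
        indicator {x | m < u x ∧ u x ≤ m + 1} (fun x => ‖v x‖ ^ p) x ≤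
      ∫ x in Ω, inner ℝ (a x (u x) (v x))
        (weakGrad Ω (fun y => trunc 1 (u y - trunc m (u y))) x) := by
    refine integral_mono_of_nonneg (Eventually.of_forall fun x => ?_) (hI.congr hIeq) ?_
    · exact mul_nonneg (by positivity) (indicator_nonneg (fun _ _ => by positivity) _)
    · filter_upwards [hslice, hu.nonneg, hab] with x h1 h2 h3
      rw [h1]
      by_cases hx : m < u x ∧ u x ≤ m + 1
      · rw [indicator_of_mem (by rw [mem_ofPred_eq]; exact hx),
          indicator_of_mem (by rw [mem_ofPred_eq]; exact hx)]
        refine le_trans ?_ (h3 _ _)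
        gcongr
        refine le_trans ?_ (hbα _)
        rw [abs_of_nonneg h2]
        exact div_le_div_of_nonneg_left hα.le (by positivity)
          (Real.rpow_le_rpow (by positivity) (by linarith [hx.2]) hτ)
      · rw [indicator_of_notMem (by rw [mem_ofPred_eq]; exact hx),
          indicator_of_notMem (by rw [mem_ofPred_eq]; exact hx), inner_zero_right, mul_zero]
  rw [integral_const_mul] at hlow
  have hfin := hlow.trans (hent.trans hsrc)
  have hpos : 0 < (2 + m) ^ τ := by positivity
  rw [div_mul_eq_mul_div, le_div_iff₀ hα]
  rw [div_mul_eq_mul_div, div_le_iff₀ hpos] at hfin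
  linarith

/-- The weights of the slices below the level `K` add up to at most `K ^ (τ + 1 - γ)`, up to a
constant. -/
theorem sum_slice_weight_le (hτ : 0 ≤ τ) (hγ : 0 ≤ γ) {m K : ℕ} (hm : 1 ≤ m) (hmK : m ≤ K)
    (s : ℝ) :
    ∑ n ∈ Finset.Ico m K, (2 + (n : ℝ)) ^ τ * (if (n : ℝ) < s then 1 / s ^ γ else 0) ≤
      2 * 3 ^ τ * max 1 ((K : ℝ) ^ (τ + 1 - γ)) := by
  have hR : 0 ≤ 2 * 3 ^ τ * max 1 ((K : ℝ) ^ (τ + 1 - γ)) := by positivity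
  have hK1 : (1 : ℝ) ≤ K := by exact_mod_cast hm.trans hmK
  rcases le_or_gt s m with hsm | hsm
  · rw [Finset.sum_eq_zero]
    · exact hR
    · intro n hn
      have : (m : ℝ) ≤ n := by exact_mod_cast (Finset.mem_Ico.1 hn).1
      rw [if_neg (by linarith), mul_zero]
  have hm1 : (1 : ℝ) ≤ m := by exact_mod_cast hm
  have hs1 : 1 ≤ s := by linarith
  -- Only n < μ contribute. As μ ≥ 1, each such term is at most (3μ)^τ μ^{-γ}, and there are at most
  -- ⌈μ⌉₊ ≤ 2μ of them.
  set μ := min s K with hμ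
  have hμ1 : 1 ≤ μ := le_min hs1 hK1
  have hμ0 : 0 < μ := by linarith
  have hterm : ∀ n ∈ Finset.Ico m K,
      (2 + (n : ℝ)) ^ τ * (if (n : ℝ) < s then 1 / s ^ γ else 0) ≤
        if n < ⌈μ⌉₊ then (3 * μ) ^ τ * (1 / μ ^ γ) else 0 := by
    intro n hn
    have hnK : (n : ℝ) < K := by exact_mod_cast (Finset.mem_Ico.1 hn).2
    by_cases hns : (n : ℝ) < s
    · have hnμ : (n : ℝ) < μ := lt_min hns hnK
      rw [if_pos hns, if_pos (Nat.lt_ceil.2 hnμ)]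
      have hμs : μ ≤ s := min_le_left _ _
      gcongr
      linarith
    · rw [if_neg hns, mul_zero]
      split_ifs <;> positivity
  have hcard : (((Finset.Ico m K).filter (fun n => n < ⌈μ⌉₊)).card : ℝ) ≤ 2 * μ := by
    have h1 : ((Finset.Ico m K).filter (fun n => n < ⌈μ⌉₊)).card ≤ ⌈μ⌉₊ := by
      refine (Finset.card_le_card (t := Finset.range ⌈μ⌉₊) fun n hn => ?_).trans (by simp)
      exact Finset.mem_range.2 (Finset.mem_filter.1 hn).2
    have h2 : (⌈μ⌉₊ : ℝ) < μ + 1 := Nat.ceil_lt_add_one hμ0.le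
    have h3 : (((Finset.Ico m K).filter (fun n => n < ⌈μ⌉₊)).card : ℝ) ≤ ⌈μ⌉₊ := by
      exact_mod_cast h1
    linarith
  refine (Finset.sum_le_sum hterm).trans ?_
  rw [← Finset.sum_filter, Finset.sum_const, nsmul_eq_mul]
  calc _ ≤ 2 * μ * ((3 * μ) ^ τ * (1 / μ ^ γ)) := by gcongr
    _ = 2 * 3 ^ τ * μ ^ (τ + 1 - γ) := by
      rw [Real.mul_rpow (by norm_num) hμ0.le, Real.rpow_sub hμ0, Real.rpow_add_one hμ0.ne']
      ring
    _ ≤ _ := by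
      gcongr
      rcases le_total 0 (τ + 1 - γ) with hσ | hσ
      · exact (Real.rpow_le_rpow hμ0.le (min_le_right _ _) hσ).trans (le_max_right _ _)
      · exact (Real.rpow_le_one_of_one_le_of_nonpos hμ1 hσ).trans (le_max_left _ _)

theorem IsTruncGrad.integrable_indicator_rpow (hΩ : IsOpen Ω) (hp : 0 < p)
    {v : EuclideanSpace ℝ (Fin N) → EuclideanSpace ℝ (Fin N)} (hv : IsTruncGrad Ω u v)
    {k : ℝ} (hk : 0 < k) (hu : MemW0 Ω p (fun x => trunc k (u x))) :
    Integrable (indicator {x | |u x| ≤ k} fun x => ‖v x‖ ^ p) (volume.restrict Ω) ∧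
    eLpNorm (indicator {x | |u x| ≤ k} v) (ENNReal.ofReal p) (volume.restrict Ω) =
      ENNReal.ofReal ((∫ x in Ω, indicator {x | |u x| ≤ k} (fun x => ‖v x‖ ^ p) x) ^ p⁻¹) := by
  have hL := hv.memLp_indicator hΩ hk hu
  have hp0 : ENNReal.ofReal p ≠ 0 := by simpa using hp
  have heq : (indicator {x | |u x| ≤ k} fun x => ‖v x‖ ^ p) =
      fun x => ‖indicator {x | |u x| ≤ k} v x‖ ^ p := by
    ext x
    by_cases hx : |u x| ≤ k <;> simp [indicator, hx, hp.ne']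
  rw [heq, hL.eLpNorm_eq_integral_rpow_norm hp0 ENNReal.ofReal_ne_top,
    ENNReal.toReal_ofReal hp.le]
  have h1 := hL.integrable_norm_rpow hp0 ENNReal.ofReal_ne_top
  rw [ENNReal.toReal_ofReal hp.le] at h1
  exact ⟨h1, rfl⟩

/-- The energy of the truncations of an entropy solution. -/
theorem IsEntropySolution.exists_energy_le (hΩ : IsOpen Ω) (hΩb : Bornology.IsBounded Ω)
    (hp : 1 < p) (hγ : 0 ≤ γ) {b : ℝ → ℝ} (hα : 0 < α) (hτ : 0 ≤ τ)
    (hbα : ∀ s : ℝ, α / (1 + |s|) ^ τ ≤ b s)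
    (hab : ∀ᵐ x ∂(volume.restrict Ω), ∀ (s : ℝ) (ξ : EuclideanSpace ℝ (Fin N)),
      b s * ‖ξ‖ ^ p ≤ inner ℝ (a x s ξ) ξ)
    (hc₂ : 0 < c₂) (hh₂ : ∀ s : ℝ, s₂ ≤ s → h s ≤ ENNReal.ofReal (c₂ / s ^ γ))
    (hf : Integrable f (volume.restrict Ω)) (hf0 : ∀ᵐ x ∂(volume.restrict Ω), 0 ≤ f x)
    (hu : IsEntropySolution Ω p a h f u) :
    ∃ C : ℝ, 0 ≤ C ∧ ∀ k : ℝ, 1 ≤ k →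
      eLpNorm (indicator {x | |u x| ≤ k} (truncGrad Ω u)) (ENNReal.ofReal p)
        (volume.restrict Ω) ≤ ENNReal.ofReal ((C * max 1 (k ^ (τ + 1 - γ))) ^ p⁻¹) := by
  have hv := hu.isTruncGrad hΩ hΩb hp
  set v := truncGrad Ω u with hvdef
  set E : ℝ → ℝ := fun k => ∫ x in Ω, indicator {x | |u x| ≤ k} (fun x => ‖v x‖ ^ p) x with hE
  have hp0 : 0 < p := by linarith
  have hint : ∀ k : ℝ, 0 < k →
      Integrable (indicator {x | |u x| ≤ k} fun x => ‖v x‖ ^ p) (volume.restrict Ω) := fun k hk =>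
    (hv.integrable_indicator_rpow hΩ hp0 hk (hu.trunc_mem k hk)).1
  have hE0 : ∀ k, 0 ≤ E k := fun k => integral_nonneg fun x =>
    indicator_nonneg (fun _ _ => by positivity) _
  -- First slice: a positive integer level beyond s₂. The finite energy E m below it is absorbed
  -- into C.
  set m : ℕ := max 1 ⌈s₂⌉₊ with hm
  have hm1 : 1 ≤ m := le_max_left _ _
  have hm1' : (1 : ℝ) ≤ m := by exact_mod_cast hm1
  have hms : s₂ ≤ m := (Nat.le_ceil s₂).trans (by exact_mod_cast le_max_right _ _)
  have hstep : ∀ n : ℕ, m ≤ n → E ((n : ℝ) + 1) ≤ E n + (2 + (n : ℝ)) ^ τ / α *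
      ∫ x in Ω, indicator {x | (n : ℝ) < u x} (fun x => c₂ / u x ^ γ * f x) x := by
    intro n hn
    have hmn : (m : ℝ) ≤ n := by exact_mod_cast hn
    have hn0 : (0 : ℝ) < n := by linarith
    have h1 := hu.slice_energy_le hΩ hΩb hp hγ hα hτ hbα hab hc₂ hh₂ hf hf0 hn0
      (hms.trans hmn)
    have h2 : E ((n : ℝ) + 1) - E n = ∫ x in Ω,
        indicator {x | (n : ℝ) < u x ∧ u x ≤ n + 1} (fun x => ‖v x‖ ^ p) x := by
      rw [hE, ← integral_sub (hint _ (by linarith)) (hint _ hn0)]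
      refine integral_congr_ae ?_
      filter_upwards [hu.nonneg] with x hx
      simp only [indicator, mem_ofPred_eq, abs_of_nonneg hx]
      by_cases h1 : u x ≤ n
      · simp [h1, h1.trans (le_add_of_nonneg_right zero_le_one)]
      · simp [h1, not_le.1 h1]
    linarith
  have hsum : ∀ K : ℕ, m ≤ K → E K ≤ E m + ∑ n ∈ Finset.Ico m K, (2 + (n : ℝ)) ^ τ / α *
      ∫ x in Ω, indicator {x | (n : ℝ) < u x} (fun x => c₂ / u x ^ γ * f x) x := by
    intro K hK
    induction K, hK using Nat.le_induction with
    | base => simp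
    | succ n hn ih =>
      rw [Finset.sum_Ico_succ_top hn, Nat.cast_add_one]
      linarith [hstep n hn]
  set I := ∫ x in Ω, f x with hI
  have hI0 : 0 ≤ I := integral_nonneg_of_ae hf0
  -- The sum is taken under the integral sign. Bounding each slice by n^{-γ} times the integral of f
  -- would lose a logarithm when τ + 1 - γ = 0, a case in which bounded energy is needed.
  have hbound : ∀ K : ℕ, m ≤ K →
      E K ≤ E m + c₂ / α * (2 * 3 ^ τ * max 1 ((K : ℝ) ^ (τ + 1 - γ))) * I := by
    intro K hK
    refine (hsum K hK).trans (add_le_add_right ?_ _)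
    have hi : ∀ n ∈ Finset.Ico m K, Integrable (fun x => (2 + (n : ℝ)) ^ τ / α *
        indicator {x | (n : ℝ) < u x} (fun x => c₂ / u x ^ γ * f x) x) (volume.restrict Ω) := by
      intro n hn
      have hmn : (m : ℝ) ≤ n := by exact_mod_cast (Finset.mem_Ico.1 hn).1
      exact (integrable_indicator_source hγ hf hu.meas (by linarith)).const_mul _
    simp only [← integral_const_mul]
    rw [← integral_finsetSum _ hi, hI, ← integral_const_mul]
    refine integral_mono_ae (integrable_finsetSum _ hi) (hf.const_mul _) ?_
    filter_upwards [hf0] with x hfx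
    have h1 := sum_slice_weight_le hτ hγ hm1 hK (u x)
    have h2 : ∑ n ∈ Finset.Ico m K, (2 + (n : ℝ)) ^ τ / α *
        indicator {x | (n : ℝ) < u x} (fun x => c₂ / u x ^ γ * f x) x =
        c₂ / α * (∑ n ∈ Finset.Ico m K,
          (2 + (n : ℝ)) ^ τ * (if (n : ℝ) < u x then 1 / u x ^ γ else 0)) * f x := by
      rw [Finset.mul_sum, Finset.sum_mul]
      refine Finset.sum_congr rfl fun n _ => ?_
      by_cases hn : (n : ℝ) < u x
      · simp only [indicator, mem_ofPred_eq, hn, if_true]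
        ring
      · simp [indicator, hn]
    rw [h2]
    gcongr
  -- D pays for replacing the real level k by an integer K ≥ k with K ≤ 2mk.
  set D := max 1 ((2 * m : ℝ) ^ (τ + 1 - γ)) with hD
  have hD1 : 1 ≤ D := le_max_left _ _
  refine ⟨E m + c₂ / α * (2 * 3 ^ τ * D) * I, by have := hE0 m; positivity, fun k hk => ?_⟩
  have hk0 : 0 < k := by linarith
  rw [(hv.integrable_indicator_rpow hΩ hp0 hk0 (hu.trunc_mem k hk0)).2]
  refine ENNReal.ofReal_le_ofReal (Real.rpow_le_rpow (hE0 k) ?_ (by positivity))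
  set K : ℕ := max m ⌈k⌉₊ with hK
  have hkK : k ≤ K := (Nat.le_ceil k).trans (by exact_mod_cast le_max_right _ _)
  have hK1 : (1 : ℝ) ≤ K := hk.trans hkK
  have hKk : (K : ℝ) ≤ 2 * m * k := by
    have h1 : (⌈k⌉₊ : ℝ) < k + 1 := Nat.ceil_lt_add_one hk0.le
    have h2 : k ≤ m * k := le_mul_of_one_le_left hk0.le hm1'
    rw [hK, Nat.cast_max]
    exact max_le (by nlinarith) (by linarith)
  set M := max 1 (k ^ (τ + 1 - γ)) with hM
  have hM1 : 1 ≤ M := le_max_left _ _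
  have hDM : max 1 ((K : ℝ) ^ (τ + 1 - γ)) ≤ D * M := by
    have hDM1 : 1 ≤ D * M := one_le_mul_of_one_le_of_one_le hD1 hM1
    refine max_le hDM1 ?_
    rcases le_total 0 (τ + 1 - γ) with hσ | hσ
    · calc (K : ℝ) ^ (τ + 1 - γ) ≤ (2 * m * k) ^ (τ + 1 - γ) := by gcongr
        _ = (2 * m : ℝ) ^ (τ + 1 - γ) * k ^ (τ + 1 - γ) :=
          Real.mul_rpow (by positivity) hk0.le
        _ ≤ D * M := by
          gcongr
          · exact le_max_right _ _
          · exact le_max_right _ _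
    · exact (Real.rpow_le_one_of_one_le_of_nonpos hK1 hσ).trans hDM1
  have hEk : E k ≤ E K := by
    refine integral_mono (hint k hk0) (hint K (by linarith)) fun x => ?_
    refine indicator_le_indicator_of_subset (fun y hy => ?_) (fun _ => by positivity) x
    rw [mem_ofPred_eq] at hy ⊢
    exact hy.trans hkK
  calc E k ≤ E m + c₂ / α * (2 * 3 ^ τ * max 1 ((K : ℝ) ^ (τ + 1 - γ))) * I :=
        hEk.trans (hbound K (le_max_left _ _))
    _ ≤ E m * M + c₂ / α * (2 * 3 ^ τ * (D * M)) * I := by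
      gcongr
      exact le_mul_of_one_le_right (hE0 m) hM1
    _ = _ := by ring

end Energy

/-! ### Identification of the exponents -/

theorem lemma5p3
    (N : ℕ) (hN : 2 ≤ N)
    (Ω : Set (EuclideanSpace ℝ (Fin N))) (hΩ : IsOpen Ω) (hΩb : Bornology.IsBounded Ω)
    (p : ℝ) (hp : 1 < p) (hpN : p < N)
    (θ γ₂ : ℝ) (hθ : 0 ≤ θ) (hγ₂ : 0 ≤ γ₂) (hθγ : θ < 1 + γ₂ / (p - 1))
    (a : EuclideanSpace ℝ (Fin N) → ℝ → EuclideanSpace ℝ (Fin N) → EuclideanSpace ℝ (Fin N))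
    (ha : IsCaratheodory Ω a)
    (b : ℝ → ℝ) (hb : Continuous b) (hb_bdd : ∃ B : ℝ, ∀ s : ℝ, |b s| ≤ B)
    (α : ℝ) (hα : 0 < α) (hbα : ∀ s : ℝ, α / (1 + |s|) ^ (θ * (p - 1)) ≤ b s)
    (hab : ∀ᵐ x ∂(volume.restrict Ω), ∀ (s : ℝ) (ξ : EuclideanSpace ℝ (Fin N)),
      b s * ‖ξ‖ ^ p ≤ inner ℝ (a x s ξ) ξ)
    (h : ℝ → ℝ≥0∞) (hh : ContinuousOn h (Ici 0)) (hh_fin : ∀ s : ℝ, 0 < s → h s < ⊤)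
    (c₂ s₂ : ℝ) (hc₂ : 0 < c₂) (hs₂ : 0 < s₂)
    (hh₂ : ∀ s : ℝ, s₂ ≤ s → h s ≤ ENNReal.ofReal (c₂ / s ^ γ₂))
    (f : EuclideanSpace ℝ (Fin N) → ℝ) (hf : MemLp f 1 (volume.restrict Ω))
    (hf_nonneg : ∀ᵐ x ∂(volume.restrict Ω), 0 ≤ f x)
    (u : EuclideanSpace ℝ (Fin N) → ℝ) (hu : IsEntropySolution Ω p a h f u) :
    (1 ≤ γ₂ → θ ≤ (γ₂ - 1) / (p - 1) → MemW0 Ω p u) ∧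
    (max 0 ((γ₂ - 1) / (p - 1)) ≤ θ →
      MemMarcinkiewicz Ω (N * ((p - 1) * (1 - θ) + γ₂) / (N - p)) u ∧
      MemMarcinkiewicz Ω (N * ((p - 1) * (1 - θ) + γ₂) / (N - θ * (p - 1) - 1 + γ₂))
        (fun x => ‖truncGrad Ω u x‖)) := by
  have hp0 : 0 < p - 1 := by linarith
  have hNp : (0 : ℝ) < N - p := by linarith
  have hτ : 0 ≤ θ * (p - 1) := by positivity
  -- This quantity is p - σ with σ = θ(p-1) + 1 - γ₂.
  have hD : 0 < (p - 1) * (1 - θ) + γ₂ := by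
    have h1 : θ * (p - 1) < (1 + γ₂ / (p - 1)) * (p - 1) := mul_lt_mul_of_pos_right hθγ hp0
    rw [add_mul, div_mul_cancel₀ _ hp0.ne'] at h1
    linarith
  have hv := hu.isTruncGrad hΩ hΩb hp
  obtain ⟨C, hC0, hC⟩ := hu.exists_energy_le hΩ hΩb hp hγ₂ hα hτ hbα hab hc₂ hh₂
    (memLp_one_iff_integrable.1 hf) hf_nonneg
  constructor
  · intro _ hle
    rw [le_div_iff₀ hp0] at hle
    refine hv.memW0_of_bound hΩ hΩb hp hpN hu.meas hu.trunc_mem (C := C ^ p⁻¹) fun k hk => ?_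
    have h1 := hC k hk
    rwa [max_eq_left (Real.rpow_le_one_of_one_le_of_nonpos hk (by linarith)), mul_one] at h1
  · intro hge
    have hσ : 0 ≤ θ * (p - 1) + 1 - γ₂ := by
      have h1 := (le_max_right _ _).trans hge
      rw [div_le_iff₀ hp0] at h1
      linarith
    have hC' : ∀ k : ℝ, 1 ≤ k →
        eLpNorm (indicator {x | |u x| ≤ k} (truncGrad Ω u)) (ENNReal.ofReal p)
          (volume.restrict Ω) ≤
          ENNReal.ofReal (C ^ p⁻¹ * k ^ ((θ * (p - 1) + 1 - γ₂) / p)) := by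
      intro k hk
      have h1 := hC k hk
      rwa [max_eq_right (Real.one_le_rpow hk hσ), Real.mul_rpow hC0 (by positivity),
        ← Real.rpow_mul (by linarith), ← div_eq_mul_inv] at h1
    obtain ⟨c, hc0, hc⟩ := hv.measure_lt_le hΩ hΩb hp hpN hu.meas hu.trunc_mem
      (by positivity) hC'
    have ht : N * (p - (θ * (p - 1) + 1 - γ₂)) / (N - p) =
        N * ((p - 1) * (1 - θ) + γ₂) / (N - p) := by ring
    rw [ht] at hc
    have ht0 : 0 < N * ((p - 1) * (1 - θ) + γ₂) / (N - p) := by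
      have : (0 : ℝ) < N := by linarith
      positivity
    refine ⟨memMarcinkiewicz_of_one_le hΩ.measurableSet hΩb ht0 hu.meas hc0 hc, ?_⟩
    -- The denominator is (N - p) + (p - σ), a sum of two positive numbers.
    have hden : 0 < N - θ * (p - 1) - 1 + γ₂ := by linarith
    have hr0 : 0 < N * ((p - 1) * (1 - θ) + γ₂) / (N - θ * (p - 1) - 1 + γ₂) := by
      have : (0 : ℝ) < N := by linarith
      positivity
    refine memMarcinkiewicz_of_one_le hΩ.measurableSet hΩb hr0 hv.meas.norm
      (c := c + (C ^ p⁻¹) ^ p) (by positivity) fun l hl => ?_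
    have h1 := hv.measure_norm_lt_le hΩ (by linarith) hu.trunc_mem (by positivity) hC' hc0 hc
      hσ ht0 hl
    have hr : p * (N * ((p - 1) * (1 - θ) + γ₂) / (N - p)) /
        (N * ((p - 1) * (1 - θ) + γ₂) / (N - p) + (θ * (p - 1) + 1 - γ₂)) =
        N * ((p - 1) * (1 - θ) + γ₂) / (N - θ * (p - 1) - 1 + γ₂) := by
      have hsum : N * ((p - 1) * (1 - θ) + γ₂) / (N - p) + (θ * (p - 1) + 1 - γ₂) =
          p * (N - θ * (p - 1) - 1 + γ₂) / (N - p) := by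
        field_simp
        ring
      have hp' : p ≠ 0 := by linarith
      rw [hsum]
      field_simp
    rw [hr] at h1
    simpa only [abs_norm] using h1
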